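/- **Conventions.** Fix a one-sorted signature $\Sigma$. A term $t\in CT_\Sigma(X)$ is a possibly infinite, possibly partial term: a partial function $t$ from finite strings of positive integers (occurrences) to $\Sigma\cup X$ such that if $t(wi)$ is defined then $t(w)$ is an operator of arity at least $i$. The empty term is $\bot$; $t\le t'$ means that $t'$ extends $t$ as a partial function; $t/w$ is the subterm at $w$. Substitutions $X\to CT_\Sigma(Y)$ are extended continuously to $CT_\Sigma(X)\to CT_\Sigma(Y)$ (postfix notation). A rewrite rule $R\colon l\to r$ consists of two terms without undefined parts, $l$ finite and not a variable, $var(r)\subseteq var(l)$. It is *non-self-overlapping* if $l$ does not unify, after renaming variables apart, with a proper non-variable subterm of itself. A redex of $t$ is a pair $(w,R)$ with $t(w)$ defined and $t/w=l\tau$ for some substitution $\tau$; contracting it replaces $t/w$ by $r\tau$. The residuals of $(w,R)$ by $(w',R'\colon l'\to r')$ are: none if the two redexes are equal; $(w,R)$ itself if $w$ is not strictly below $w'$; and $\{(w'bu,R) : r'/b=x\}$ if $w=w'au$ with $l'/a=x$ a variable. A parallel redex $\Phi$ of $t$ is a set of redexes of $t$. If $\Phi$ is finite, $t\to_\Phi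 t'$ means that some complete development of $\Phi$ (a finite sequence of contractions of residuals of $\Phi$ after which no residual is left) ends in $t'$. If $\Phi$ is infinite, $t\to_\Phi t'$ means that there is a chain $t_0\le t_1\le\cdots$ with least upper bound $t$ such that for each $i$ every $(w,R)\in\Phi$ is a redex of $t_i$ or $t_i(w)$ is undefined, the set $\Phi_i$ of members of $\Phi$ that are redexes of $t_i$ is finite, and $t_i\to_{\Phi_i}d_i$, where $(d_i)$ is a chain with least upper bound $t'$. A term graph $G$ has a finite set $N_G$ of nodes and partial labelling and successor functions with common domain, a node labelled by an operator of arity $k$ having a list of $k$ successors; cycles are allowed. Nodes without label form the set $var(G)$. A morphism is a map of nodes preserving labels and successors wherever they are defined. The unraveling $\mathcal U_G[n]\in CT_\Sigma(var(G))$ maps $w$ to the label of the end node of the path from $n$ with occurrence $w$ (to that node itself if it lies in $var(G)$), and is undefined at $w$ if there is no such path. An evaluation rule $p=(L\xleftarrow{\,l\,}K\xrightarrow{\,r\,}R)$ consists of a tree $L$ (exactly one path from its root $\underline n$ to each node) whose root is labelled, the graph $K$ obtained from $L$ by removing label and successors of $\underline n$, the inclusion $l$, and a morphism $r$ restricting to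 a bijection $var(L)\to var(R)$ ($r$ need not be injective, so collapsing rules are allowed). Its unraveling $\mathcal U[p]$ is the rewrite rule $\mathcal U_L[\underline n]\to\mathcal U_R[r(\underline n)]\rho$, where $\rho$ renames $r(y)$ to $y$ for $y\in var(L)$; $p$ is non-self-overlapping if $\mathcal U[p]$ is. For a morphism $g\colon L\to G$, a direct derivation $G\Rightarrow_{p,g}H$ consists of morphisms $k\colon K\to D$, $h\colon R\to H$, $b\colon D\to H$, where $D$ is $G$ with label and successors of $g(\underline n)$ removed, such that the squares $L\leftarrow K\to D$ over $G$ (with $g$ and the inclusion $D\to G$) and $R\leftarrow K\to D$ over $H$ are pushouts in the category of term graphs. Its track function is $tr=b\colon N_G=N_D\to N_H$. **Theorem.** Let $p$ be a non-self-overlapping evaluation rule, $G$ a (possibly cyclic) term graph and $g\colon L\to G$ a morphism. Then a direct derivation $G\Rightarrow_{p,g}H$ exists, and for every such direct derivation with track function $tr$: 1. $tr$ maps $var(G)$ injectively into $var(H)$, so that the substitution $\sigma\colon var(H)\to CT_\Sigma(var(G))$ with $x\sigma=y$ if $y\in var(G)$ and $tr(y)=x$, and $x\sigma=\bot$ if there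 is no such $y$, is well defined; 2. for every node $n\in N_G$, $$\mathcal U_G[n]\;\to_\Phi\;\mathcal U_H[tr(n)]\,\sigma ,$$ where $\Phi$ is the (possibly infinite) parallel redex $\Phi=\{(w,\mathcal U[p]) : w \text{ is the occurrence of a path in } G \text{ from } n \text{ to } g(\underline n)\}$. -/

import Mathlib

open CategoryTheory

universe u v w z

/-- A one-sorted signature: a type of operator symbols, each with an arity. -/
structure Signature where
  Op : Type v
  arity : Op → ℕ

/-! ### Possibly infinite, possibly partial terms -/

/-- A possibly infinite, possibly partial term over `(S, X)`: a partial function from occurrences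
to `S ∪ X`. An occurrence is a finite string of argument positions; the `(i+1)`-st argument of an
operator is encoded by the number `i`, so an operator of arity `k` has the positions `i < k`. -/
@[ext]
structure Term (S : Signature.{v}) (X : Type w) where
  val : List ℕ → Option (S.Op ⊕ X)
  closed : ∀ (o : List ℕ) (i : ℕ), val (o ++ [i]) ≠ none →
    ∃ f : S.Op, val o = some (Sum.inl f) ∧ i < S.arity f

namespace Term

variable {S : Signature.{v}} {X : Type w} {Y : Type z}

/-- The approximation order: `t ≤ t'` iff `t` is less defined than `t'` as a partial function. -/
instance : PartialOrder (Term S X) where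
  le t t' := ∀ o, t.val o ≠ none → t'.val o = t.val o
  le_refl _ _ _ := rfl
  le_trans a b c hab hbc o ho := by
    rw [hbc o (by rw [hab o ho]; exact ho), hab o ho]
  le_antisymm a b hab hba := by
    apply Term.ext
    funext o
    by_cases h : a.val o = none
    · by_cases h' : b.val o = none
      · rw [h, h']
      · exact hba o h'
    · exact (hab o h).symm

/-- The empty term. -/
instance : Bot (Term S X) where
  bot := ⟨fun _ => none, fun _ _ h => absurd rfl h⟩

/-- A variable, as a term. -/
def var (x : X) : Term S X where
  val o := if o = [] then some (Sum.inr x) else none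
  closed o i h := by simp at h

/-- The set of occurrences of a term. -/
def occ (t : Term S X) : Set (List ℕ) := {o | t.val o ≠ none}

/-- A term without undefined parts. -/
def IsTotal (t : Term S X) : Prop :=
  t.val [] ≠ none ∧
    ∀ o f i, t.val o = some (Sum.inl f) → i < S.arity f → t.val (o ++ [i]) ≠ none

/-- The subterm `t / o`. -/
def sub (t : Term S X) (o : List ℕ) : Term S X where
  val q := t.val (o ++ q)
  closed q i h := t.closed (o ++ q) i (by rwa [List.append_assoc])

/-- The replacement `t[o ← s]`; nothing happens if `t / o = ⊥`. -/
noncomputable def replace (t : Term S X) (o : List ℕ) (s : Term S X) : Term S X where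
  val q := open Classical in
    if t.val o ≠ none ∧ o <+: q then s.val (q.drop o.length) else t.val q
  closed q i h := by
    classical
    by_cases ho : t.val o ≠ none
    · by_cases h1 : o <+: q
      · have h2 : o <+: q ++ [i] := h1.trans (List.prefix_append _ _)
        rw [if_pos ⟨ho, h2⟩, List.drop_append_of_le_length h1.length_le] at h
        rw [if_pos ⟨ho, h1⟩]
        exact s.closed _ _ h
      · rw [if_neg (fun hh => h1 hh.2)]
        by_cases h2 : o <+: q ++ [i]
        · have h3 : o = q ++ [i] := by
            rcases List.prefix_concat_iff.1 h2 with h3 | h3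
            · simpa using h3
            · exact absurd h3 h1
          exact t.closed q i (h3 ▸ ho)
        · rw [if_neg (fun hh => h2 hh.2)] at h
          exact t.closed q i h
    · rw [if_neg (fun hh => ho hh.1)] at h ⊢
      exact t.closed q i h

/-- The value of `t σ` at an occurrence: if a prefix of it is an occurrence in `t` of a variable
`x`, it is the value of `σ x` at the rest, and otherwise it is the value of `t`. -/
def substVal (σ : X → Term S Y) :
    (List ℕ → Option (S.Op ⊕ X)) → List ℕ → Option (S.Op ⊕ Y)
  | t, [] =>
    match t [] with
    | none => none
    | some (Sum.inl f) => some (Sum.inl f)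
    | some (Sum.inr x) => (σ x).val []
  | t, i :: q =>
    match t [] with
    | none => none
    | some (Sum.inl _) => substVal σ (fun r => t (i :: r)) q
    | some (Sum.inr x) => (σ x).val (i :: q)

theorem substVal_closed (σ : X → Term S Y) (o : List ℕ) :
    ∀ (t : List ℕ → Option (S.Op ⊕ X)),
      (∀ (o : List ℕ) (i : ℕ), t (o ++ [i]) ≠ none →
        ∃ f : S.Op, t o = some (Sum.inl f) ∧ i < S.arity f) →
      ∀ i, substVal σ t (o ++ [i]) ≠ none →
        ∃ f : S.Op, substVal σ t o = some (Sum.inl f) ∧ i < S.arity f := by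
  induction o with
  | nil =>
    intro t ht i h
    rcases h0 : t [] with _ | f | x
    · simp [substVal, h0] at h
    · have h1 : t ([] ++ [i]) ≠ none := by
        intro h2
        rw [List.nil_append] at h2
        simp [substVal, h0, h2] at h
      obtain ⟨f', hf, hi⟩ := ht [] i h1
      exact ⟨f', by simp [substVal, hf], hi⟩
    · simp only [List.nil_append, substVal, h0] at h ⊢
      exact (σ x).closed [] i h
  | cons j q ih =>
    intro t ht i h
    rcases h0 : t [] with _ | f | x
    · simp [substVal, h0] at h
    · simp only [List.cons_append, substVal, h0] at h ⊢
      exact ih (fun r => t (j :: r)) (fun o i h => ht (j :: o) i h) i h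
    · simp only [List.cons_append, substVal, h0] at h ⊢
      exact (σ x).closed (j :: q) i h

/-- The application `t σ` of a substitution `σ : X → CT(Y)` to a term. -/
def subst (t : Term S X) (σ : X → Term S Y) : Term S Y where
  val := substVal σ t.val
  closed o i h := substVal_closed σ o t.val t.closed i h

end Term

/-! ### Rewrite rules and parallel term rewriting -/

/-- A (left-finite) term rewrite rule. -/
structure RewriteRule (S : Signature.{v}) (X : Type w) where
  lhs : Term S X
  rhs : Term S X
  lhs_total : lhs.IsTotal
  rhs_total : rhs.IsTotal
  lhs_finite : lhs.occ.Finite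
  lhs_ne_var : ∀ x, lhs ≠ Term.var x
  var_subset : ∀ x, (∃ o, rhs.val o = some (Sum.inr x)) → ∃ o, lhs.val o = some (Sum.inr x)

/-- The left-hand side does not unify (after renaming the variables apart) with a proper
non-variable subterm of itself. -/
def RewriteRule.NonSelfOverlapping {S : Signature.{v}} {X : Type w} (R : RewriteRule S X) : Prop :=
  ¬ ∃ (o : List ℕ) (f : S.Op), o ≠ [] ∧ R.lhs.val o = some (Sum.inl f) ∧
    ∃ σ τ : X → Term S X, R.lhs.subst σ = (R.lhs.sub o).subst τ

namespace Term

variable {S : Signature.{v}} {X : Type w} {Y : Type z}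

/-- The pair `Δ = (o, R)` is a redex of `t`: `o` is an occurrence of `t` and `t / o` is an instance
of the left-hand side of `R`. -/
def IsRedex (t : Term S Y) (Δ : List ℕ × RewriteRule S X) : Prop :=
  Δ.1 ∈ t.occ ∧ ∃ τ : X → Term S Y, t.sub Δ.1 = Δ.2.lhs.subst τ

/-- `t` reduces to `t'` via the redex `Δ`. -/
def Reduces (Δ : List ℕ × RewriteRule S X) (t t' : Term S Y) : Prop :=
  Δ.1 ∈ t.occ ∧ ∃ τ : X → Term S Y,
    t.sub Δ.1 = Δ.2.lhs.subst τ ∧ t' = t.replace Δ.1 (Δ.2.rhs.subst τ)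

end Term

section ParallelRewriting

variable {S : Signature.{v}} {X : Type w} {Y : Type z}

/-- The residuals of `Δ` by `Δ'`: none if `Δ = Δ'`; `Δ` itself if its occurrence is not strictly
below that of `Δ'`; and if it lies below a variable of the left-hand side of `Δ'`, one copy for
each occurrence of that variable in the right-hand side. -/
def residuals (Δ Δ' : List ℕ × RewriteRule S X) : Set (List ℕ × RewriteRule S X) :=
  {Δ'' | (Δ ≠ Δ' ∧ ¬ (Δ'.1 <+: Δ.1 ∧ Δ'.1 ≠ Δ.1) ∧ Δ'' = Δ) ∨
    ∃ (a b q : List ℕ) (x : X), Δ.1 = Δ'.1 ++ a ++ q ∧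
      Δ'.2.lhs.val a = some (Sum.inr x) ∧ Δ'.2.rhs.val b = some (Sum.inr x) ∧
      Δ'' = (Δ'.1 ++ b ++ q, Δ.2)}

/-- The residuals of a set of redexes by a redex. -/
def residualSet (Φ : Set (List ℕ × RewriteRule S X)) (Δ' : List ℕ × RewriteRule S X) :
    Set (List ℕ × RewriteRule S X) :=
  ⋃ Δ ∈ Φ, residuals Δ Δ'

/-- `CompleteDevelopment Φ t t'`: some complete development of the set of redexes `Φ` of `t` (a
finite reduction sequence that always contracts a residual of a member of `Φ`, until no residual
is left) ends in `t'`. -/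
inductive CompleteDevelopment :
    Set (List ℕ × RewriteRule S X) → Term S Y → Term S Y → Prop
  | nil (t : Term S Y) : CompleteDevelopment ∅ t t
  | cons {Φ : Set (List ℕ × RewriteRule S X)} {Δ : List ℕ × RewriteRule S X}
      {t t' t'' : Term S Y} (hΔ : Δ ∈ Φ) (hred : Term.Reduces Δ t t')
      (hdev : CompleteDevelopment (residualSet Φ Δ) t' t'') : CompleteDevelopment Φ t t''

/-- Parallel reduction of a finite parallel redex. -/
def FiniteParallelReduction (Φ : Set (List ℕ × RewriteRule S X)) (t t' : Term S Y) : Prop :=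
  Φ.Finite ∧ (∀ Δ ∈ Φ, t.IsRedex Δ) ∧ CompleteDevelopment Φ t t'

/-- Parallel reduction of an infinite parallel redex: `t` is the least upper bound of a chain of
approximations `a i` such that every redex of `Φ` is a redex of `a i` or lies outside of it, and
only finitely many are redexes of `a i`; the results `d i` of the finite parallel reductions of the
`a i` form a chain, with least upper bound `t'`. -/
def InfiniteParallelReduction (Φ : Set (List ℕ × RewriteRule S X)) (t t' : Term S Y) : Prop :=
  Φ.Infinite ∧ (∀ Δ ∈ Φ, t.IsRedex Δ) ∧
    ∃ a d : ℕ → Term S Y,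
      Monotone a ∧ IsLUB (Set.range a) t ∧
      (∀ i, ∀ Δ ∈ Φ, (a i).IsRedex Δ ∨ (a i).val Δ.1 = none) ∧
      (∀ i, FiniteParallelReduction {Δ ∈ Φ | (a i).IsRedex Δ} (a i) (d i)) ∧
      Monotone d ∧ IsLUB (Set.range d) t'

/-- The relation `t →_Φ t'`, for a finite or infinite parallel redex `Φ` of `t`. -/
def ParallelReduction (Φ : Set (List ℕ × RewriteRule S X)) (t t' : Term S Y) : Prop :=
  FiniteParallelReduction Φ t t' ∨ InfiniteParallelReduction Φ t t'

end ParallelRewriting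

/-! ### Term graphs -/

/-- A finite, possibly cyclic term graph. The labelling and the successor function are partial
functions with the same domain, so they are given together: `data n = some ⟨f, s⟩` says that `n`
has label `f` and successors `s 0, …, s (k - 1)`, where `k` is the arity of `f`. -/
structure TermGraph (S : Signature.{v}) where
  Node : Type u
  finite_node : Finite Node
  data : Node → Option ((f : S.Op) × (Fin (S.arity f) → Node))

namespace TermGraph

variable {S : Signature.{v}}

/-- A morphism of term graphs: a map of nodes which preserves labels and successors wherever they
are defined. -/
@[ext]
structure Hom (G H : TermGraph.{u, v} S) where
  node : G.Node → H.Node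
  map_data : ∀ n f s, G.data n = some ⟨f, s⟩ → H.data (node n) = some ⟨f, node ∘ s⟩

/-- The category of term graphs. -/
instance : Category.{u} (TermGraph.{u, v} S) where
  Hom := Hom
  id _ := ⟨id, fun _ _ _ h => h⟩
  comp a b := ⟨b.node ∘ a.node, fun n f s h => b.map_data _ _ _ (a.map_data n f s h)⟩

/-- The action of a morphism on nodes. -/
def nodeMap {G H : TermGraph.{u, v} S} (a : G ⟶ H) : G.Node → H.Node := Hom.node a

/-- The set of variable nodes (empty nodes). -/
def varSet (G : TermGraph.{u, v} S) : Set G.Node := {n | G.data n = none}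

/-- The type of variable nodes. -/
abbrev Var (G : TermGraph.{u, v} S) : Type u := {n : G.Node // G.data n = none}

/-- `G.follow n o` is the end node of the unique path of `G` that starts at `n` and has occurrence
`o`, if there is such a path. So `G.follow n o = some m` says that there is a path from `n` to `m`
with occurrence `o`. -/
def follow (G : TermGraph.{u, v} S) : G.Node → List ℕ → Option G.Node
  | n, [] => some n
  | n, i :: o =>
    match G.data n with
    | none => none
    | some ⟨f, s⟩ => if h : i < S.arity f then follow G (s ⟨i, h⟩) o else none

/-- The symbol contributed by a node to an unraveling: its label, or the node itself if it is a
variable node. -/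
def symbol (G : TermGraph.{u, v} S) (n : G.Node) : S.Op ⊕ G.Var :=
  match h : G.data n with
  | none => Sum.inr ⟨n, h⟩
  | some fs => Sum.inl fs.1

theorem symbol_inl {G : TermGraph.{u, v} S} {n : G.Node} {f : S.Op} {s : Fin (S.arity f) → G.Node}
    (h : G.data n = some ⟨f, s⟩) : G.symbol n = Sum.inl f := by
  unfold symbol
  split
  · rename_i h'; rw [h] at h'; cases h'
  · rename_i fs h'; rw [h] at h'; cases h'; rfl

theorem symbol_inr {G : TermGraph.{u, v} S} {n : G.Node} (h : G.data n = none) :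
    G.symbol n = Sum.inr ⟨n, h⟩ := by
  unfold symbol
  split
  · rfl
  · rename_i fs h'; rw [h] at h'; cases h'

theorem follow_concat (G : TermGraph.{u, v} S) (o : List ℕ) (i : ℕ) : ∀ n : G.Node,
    G.follow n (o ++ [i]) = (G.follow n o).bind (fun m => G.follow m [i]) := by
  induction o with
  | nil => intro n; simp [follow]
  | cons j q ih =>
    intro n
    rw [List.cons_append]
    rcases h : G.data n with _ | ⟨f, s⟩
    · simp [follow, h]
    · by_cases hj : j < S.arity f
      · simpa [follow, h, hj] using ih (s ⟨j, hj⟩)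
      · simp [follow, h, hj]

/-- The unraveling of `G` at the node `n`. -/
def unravel (G : TermGraph.{u, v} S) (n : G.Node) : Term S G.Var where
  val o := (G.follow n o).map G.symbol
  closed o i h := by
    rw [follow_concat] at h
    rcases h1 : G.follow n o with _ | m
    · simp [h1] at h
    · rcases h2 : G.data m with _ | ⟨f, s⟩
      · simp [h1, follow, h2] at h
      · refine ⟨f, by rw [Option.map_some, symbol_inl h2], ?_⟩
        by_contra hi
        simp [h1, follow, h2, hi] at h

/-- The graph `G` is a tree with root `n`: there is exactly one path from `n` to each node. -/
def IsTree (G : TermGraph.{u, v} S) (n : G.Node) : Prop :=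
  ∀ m : G.Node, ∃! o : List ℕ, G.follow n o = some m

open Classical in
/-- The graph obtained from `G` by making label and successors undefined on the node `m`. -/
noncomputable def erase (G : TermGraph.{u, v} S) (m : G.Node) : TermGraph.{u, v} S where
  Node := G.Node
  finite_node := G.finite_node
  data := Function.update G.data m none

theorem erase_data {G : TermGraph.{u, v} S} {m n : G.Node}
    {d : (f : S.Op) × (Fin (S.arity f) → G.Node)} (h : (G.erase m).data n = some d) :
    G.data n = some d := by
  classical
  simp only [erase, Function.update_apply] at h
  split at h
  · cases h
  · exact h

/-- The morphism `G.erase m ⟶ G` that is the identity on nodes. -/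
def eraseHom (G : TermGraph.{u, v} S) (m : G.Node) : G.erase m ⟶ G :=
  (⟨fun n => n, fun _ _ _ h => erase_data h⟩ : Hom (G.erase m) G)

end TermGraph

/-! ### Evaluation rules and direct derivations -/

/-- An evaluation rule `L ← K → R`: `L` is a tree with a non-empty root, `K` is `L` with label and
successors of the root removed, `K ⟶ L` is the inclusion, and `K ⟶ R` maps the variable nodes of
`L` bijectively to those of `R`. It need not be injective on the other nodes, so that collapsing
rules, for which the root is mapped to a variable node of `R`, are included. -/
structure EvaluationRule (S : Signature.{v}) where
  L : TermGraph.{u, v} S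
  root : L.Node
  tree : L.IsTree root
  root_nonempty : root ∉ L.varSet
  R : TermGraph.{u, v} S
  r : L.erase root ⟶ R
  bijOn_var : Set.BijOn (TermGraph.nodeMap r) L.varSet R.varSet

namespace EvaluationRule

variable {S : Signature.{v}}

/-- The interface graph. -/
noncomputable abbrev K (p : EvaluationRule.{u, v} S) : TermGraph.{u, v} S := p.L.erase p.root

/-- The inclusion of the interface graph in the left-hand side. -/
noncomputable abbrev l (p : EvaluationRule.{u, v} S) : p.K ⟶ p.L := p.L.eraseHom p.root

/-- The variable node of `L` which `r` maps to a given variable node of `R`. -/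
noncomputable def varInv (p : EvaluationRule.{u, v} S) (x : p.R.Var) : p.L.Var :=
  ⟨Classical.choose (p.bijOn_var.surjOn x.2), (Classical.choose_spec (p.bijOn_var.surjOn x.2)).1⟩

end EvaluationRule

theorem Term.substVar_val {S : Signature.{v}} {X : Type w} {Y : Type z} (σ : X → Y) (o : List ℕ) :
    ∀ (t : List ℕ → Option (S.Op ⊕ X)),
      (∀ (o : List ℕ) (i : ℕ), t (o ++ [i]) ≠ none →
        ∃ f : S.Op, t o = some (Sum.inl f) ∧ i < S.arity f) →
      Term.substVal (fun x => (Term.var (σ x) : Term S Y)) t o = (t o).map (Sum.map id σ) := by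
  have key : ∀ (t : List ℕ → Option (S.Op ⊕ X)),
      (∀ (o : List ℕ) (i : ℕ), t (o ++ [i]) ≠ none →
        ∃ f : S.Op, t o = some (Sum.inl f) ∧ i < S.arity f) →
      ∀ q : List ℕ, t q ≠ none → q ≠ [] → ∃ f, t [] = some (Sum.inl f) := by
    intro t ht q
    induction q using List.reverseRecOn with
    | nil => intro _ h; exact absurd rfl h
    | append_singleton q i ih =>
      intro h _
      obtain ⟨f, hf, -⟩ := ht q i h
      by_cases hq : q = []
      · exact ⟨f, hq ▸ hf⟩
      · exact ih (by rw [hf]; simp) hq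
  induction o with
  | nil =>
    intro t _
    rcases h0 : t [] with _ | f | x <;> simp [substVal, h0, var]
  | cons i q ih =>
    intro t ht
    rcases h0 : t [] with _ | f | x
    · have h1 : t (i :: q) = none := by
        by_contra h
        obtain ⟨f, hf⟩ := key t ht _ h (by simp)
        rw [h0] at hf
        cases hf
      simp [substVal, h0, h1]
    · simp only [substVal, h0]
      exact ih (fun r => t (i :: r)) (fun o j h => ht (i :: o) j h)
    · have h1 : t (i :: q) = none := by
        by_contra h
        obtain ⟨f, hf⟩ := key t ht _ h (by simp)
        rw [h0] at hf
        cases hf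
      simp [substVal, h0, h1, var]

namespace TermGraph

variable {S : Signature.{v}}

theorem unravel_isTotal (G : TermGraph.{u, v} S) (n : G.Node) : (G.unravel n).IsTotal := by
  refine ⟨by simp [unravel, follow], ?_⟩
  intro o f i h hi
  simp only [unravel, Option.map_eq_some_iff] at h
  obtain ⟨m, hm, hs⟩ := h
  rcases h2 : G.data m with _ | ⟨f', s⟩
  · rw [symbol_inr h2] at hs
    cases hs
  · rw [symbol_inl h2] at hs
    cases hs
    simp [unravel, follow_concat, hm, follow, h2, hi]

end TermGraph

namespace EvaluationRule

variable {S : Signature.{v}}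

/-- The term rewrite rule `U[p]`: the unraveling of `L` at its root is rewritten to the unraveling
of `R` at the image of the root, in which each variable node of `R` is renamed to the corresponding
variable node of `L`. -/
noncomputable def unravel (p : EvaluationRule.{u, v} S) : RewriteRule S p.L.Var where
  lhs := p.L.unravel p.root
  rhs := (p.R.unravel (TermGraph.nodeMap p.r p.root)).subst (fun x => Term.var (p.varInv x))
  lhs_total := p.L.unravel_isTotal p.root
  rhs_total := by
    have ht := p.R.unravel_isTotal (TermGraph.nodeMap p.r p.root)
    have hv := fun o => Term.substVar_val p.varInv o
      (p.R.unravel (TermGraph.nodeMap p.r p.root)).val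
      (p.R.unravel (TermGraph.nodeMap p.r p.root)).closed
    refine ⟨?_, ?_⟩
    · simp only [Term.subst, hv, ne_eq, Option.map_eq_none_iff]
      exact ht.1
    · intro o f i h hi
      simp only [Term.subst, hv, ne_eq, Option.map_eq_none_iff, Option.map_eq_some_iff] at h ⊢
      obtain ⟨f' | x, h1, h2⟩ := h
      · cases h2
        exact ht.2 o _ i h1 hi
      · cases h2
  lhs_finite := by
    have := p.L.finite_node
    refine Set.Finite.of_finite_image (f := fun o => p.L.follow p.root o) ?_ ?_
    · refine Set.Finite.subset (Set.finite_range (some : p.L.Node → Option p.L.Node)) ?_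
      rintro _ ⟨o, ho, rfl⟩
      rcases h : p.L.follow p.root o with _ | m
      · simp [Term.occ, TermGraph.unravel, h] at ho
      · exact ⟨m, h.symm⟩
    · intro o ho o' _ h
      rcases h1 : p.L.follow p.root o with _ | m
      · simp [Term.occ, TermGraph.unravel, h1] at ho
      · exact (p.tree m).unique h1 (h.symm.trans h1)
  lhs_ne_var x h := by
    have h1 := congrArg (fun t => Term.val t []) h
    rcases h2 : p.L.data p.root with _ | ⟨f, s⟩
    · exact p.root_nonempty h2
    · simp [TermGraph.unravel, TermGraph.follow, TermGraph.symbol_inl h2, Term.var] at h1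
  var_subset x _ := by
    obtain ⟨o, ho, -⟩ := p.tree x.1
    exact ⟨o, by simp [TermGraph.unravel, ho, TermGraph.symbol_inr x.2]⟩

/-- An evaluation rule is non-self-overlapping if its unraveling is. -/
def NonSelfOverlapping (p : EvaluationRule.{u, v} S) : Prop := p.unravel.NonSelfOverlapping

end EvaluationRule

/-- A direct derivation `G ⇒ H` by the evaluation rule `p` at the occurrence `g`: a double-pushout
diagram in the category of term graphs
```
  L ←-l-- K --r-→ R
  |       |       |
  g       k       h
  ↓       ↓       ↓
  G ←---- D --b-→ H
```
whose context graph `D` is `G` with label and successors of the image of the root of `L` removed. -/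
structure DirectDerivation {S : Signature.{v}} (p : EvaluationRule.{u, v} S)
    {G : TermGraph.{u, v} S} (g : p.L ⟶ G) (H : TermGraph.{u, v} S) where
  k : p.K ⟶ G.erase (TermGraph.nodeMap g p.root)
  h : p.R ⟶ H
  b : G.erase (TermGraph.nodeMap g p.root) ⟶ H
  left : IsPushout p.l k g (G.eraseHom (TermGraph.nodeMap g p.root))
  right : IsPushout p.r k h b

namespace DirectDerivation

variable {S : Signature.{v}} {p : EvaluationRule.{u, v} S} {G H : TermGraph.{u, v} S}
  {g : p.L ⟶ G}

/-- The track function: the context graph has the same nodes as `G`. -/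
noncomputable def track (α : DirectDerivation p g H) : G.Node → H.Node :=
  TermGraph.nodeMap (G := G.erase (TermGraph.nodeMap g p.root)) α.b

open Classical in
/-- The substitution that renames each tracked variable node of `H` back to a variable node of `G`
and sends every untracked variable node of `H` to `⊥`. -/
noncomputable def trackBack (α : DirectDerivation p g H) (x : H.Var) : Term S G.Var :=
  if hx : ∃ y : G.Var, α.track y.1 = x.1 then Term.var (Classical.choose hx) else ⊥

end DirectDerivation

/-!
Write `e` for the image in `G` of the root of `L`. Since the rule does not overlap itself, no
other operator node of `L` is mapped to `e` (`NonSelfOverlapping.eq_root`), so removing the label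
of `e` leaves the rest of every matched left-hand side intact.

*Existence.* The left square forces the context morphism `K ⟶ D` to act as `g`. For the right
square the nodes of `R` and `G` are glued along the interface. The result carries consistent
labels because the content of a node (label and successors, or the variable node of `G` it stems
from) is invariant under each elementary gluing step (`rhsContent_r`). Every other derivation has
a result that maps to this one by the universal property, which shows that variable nodes of `G`
are tracked injectively to variable nodes, and that a collapsing rule whose variable is matched by
`e` itself turns `e` into a variable node that is no track of a variable node (`exists_content`).

*Unraveling.* Hence the terms `T n = U_H[tr n] σ` satisfy the recursive equations of `G`, except
that `T e` is the instance of the right-hand side of `U[p]` by the terms `T (g x)`, and that `T e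
= ⊥` in the circular collapsing case.

*Reduction.* Cut the unraveling of `G` at `n` at all occurrences of `e` of length at least `k`
(`trunc`). Such a truncation keeps finitely many occurrences of `e`, cuts no redex there apart,
and is an instance of the left-hand side when `n = e` and `k > 0` (`trunc_root_eq_subst`).
Developing it innermost first, which avoids copying redexes into a possibly infinite right-hand
side, ends in a term `reduct g k n` that is defined by recursion on `k`
(`completeDevelopment_trunc`). The truncations have supremum `U_G[n]`, and the reducts have
supremum `T n` (`isLUB_range_reduct`). If there are only finitely many occurrences of `e`, then a
single truncation is `U_G[n]` already, and its reduct is `T n` (`reduct_eq_trackTerm`).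
-/

/-! ### Terms, substitutions and unravelings -/

namespace Term

variable {S : Signature.{v}} {X : Type w} {Y : Type z}

theorem val_bot (o : List ℕ) : (⊥ : Term S X).val o = none := rfl

theorem val_sub (t : Term S X) (o q : List ℕ) : (t.sub o).val q = t.val (o ++ q) := rfl

theorem sub_nil (t : Term S X) : t.sub [] = t := rfl

theorem bot_le' (t : Term S X) : ⊥ ≤ t := fun _ h => absurd rfl h

theorem replace_nil {t : Term S X} (h : [] ∈ t.occ) (s : Term S X) : t.replace [] s = s := by
  ext1
  funext q
  have h' : t.val [] ≠ none := h
  simp [replace, h']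

/-- The term with the operator `f` at the root and the arguments `s`. -/
def node (f : S.Op) (s : Fin (S.arity f) → Term S X) : Term S X where
  val o := match o with
    | [] => some (Sum.inl f)
    | i :: q => if h : i < S.arity f then (s ⟨i, h⟩).val q else none
  closed o i h := by
    rcases o with _ | ⟨j, q⟩
    · refine ⟨f, rfl, ?_⟩
      by_contra hi
      simp [hi] at h
    · by_cases hj : j < S.arity f
      · simp only [List.cons_append, hj, dif_pos] at h ⊢
        exact (s ⟨j, hj⟩).closed q i h
      · simp [hj] at h

theorem node_val_nil (f : S.Op) (s : Fin (S.arity f) → Term S X) :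
    (node f s).val [] = some (Sum.inl f) := rfl

theorem node_val_cons (f : S.Op) (s : Fin (S.arity f) → Term S X) (i : ℕ) (q : List ℕ) :
    (node f s).val (i :: q) = if h : i < S.arity f then (s ⟨i, h⟩).val q else none := rfl

theorem node_le_node {f : S.Op} {s s' : Fin (S.arity f) → Term S X} (h : ∀ i, s i ≤ s' i) :
    node f s ≤ node f s' := by
  rintro (_ | ⟨i, q⟩) ho
  · rfl
  · rw [node_val_cons] at ho
    rw [node_val_cons, node_val_cons]
    split_ifs with hi
    · rw [dif_pos hi] at ho
      exact h ⟨i, hi⟩ q ho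
    · rfl

theorem var_subst (x : X) (σ : X → Term S Y) : (var x : Term S X).subst σ = σ x := by
  ext1
  funext o
  rcases o with _ | ⟨i, q⟩ <;> simp [subst, substVal, var]

theorem node_subst (f : S.Op) (s : Fin (S.arity f) → Term S X) (σ : X → Term S Y) :
    (node f s).subst σ = node f (fun i => (s i).subst σ) := by
  ext1
  funext o
  rcases o with _ | ⟨i, q⟩
  · rfl
  · rw [node_val_cons]
    change substVal σ (fun r => (node f s).val (i :: r)) q = _
    by_cases h : i < S.arity f
    · simp only [node_val_cons, h, dif_pos, subst]
    · simp only [node_val_cons, h, dif_neg, not_false_eq_true]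
      rcases q with _ | ⟨_, _⟩ <;> simp [substVal]

/-- Every term is undefined, a variable, or an operator applied to terms. -/
theorem eq_bot_or_var_or_node (t : Term S X) :
    t = ⊥ ∨ (∃ x, t = var x) ∨ ∃ f s, t = node f s := by
  rcases h : t.val [] with _ | f | x
  · left
    ext1
    funext o
    induction o using List.reverseRecOn with
    | nil => exact h
    | append_singleton q i ih =>
      by_contra hq
      obtain ⟨f, hf, -⟩ := t.closed q i hq
      rw [ih] at hf
      cases hf
  · right; right
    refine ⟨f, fun i => t.sub [i.1], ?_⟩
    ext1
    funext o
    rcases o with _ | ⟨i, q⟩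
    · exact h
    · rw [node_val_cons]
      split_ifs with hi
      · rfl
      · induction q using List.reverseRecOn with
        | nil =>
          by_contra hq
          obtain ⟨f', hf, hi'⟩ := t.closed [] i hq
          rw [h] at hf
          cases hf
          exact hi hi'
        | append_singleton q j ih =>
          by_contra hq
          obtain ⟨f', hf, -⟩ := t.closed (i :: q) j hq
          rw [ih] at hf
          cases hf
  · right; left
    refine ⟨x, ?_⟩
    ext1
    funext o
    rcases o with _ | ⟨i, q⟩
    · exact h
    · have : ∀ q : List ℕ, t.val (i :: q) = none := by
        intro q
        induction q using List.reverseRecOn with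
        | nil =>
          by_contra hq
          obtain ⟨f', hf, -⟩ := t.closed [] i hq
          rw [h] at hf
          cases hf
        | append_singleton q j ih =>
          by_contra hq
          obtain ⟨f', hf, -⟩ := t.closed (i :: q) j hq
          rw [ih] at hf
          cases hf
      simp [this, var]

theorem bot_subst (σ : X → Term S Y) : (⊥ : Term S X).subst σ = ⊥ := by
  ext1
  funext o
  rcases o with _ | ⟨i, q⟩ <;> simp [subst, substVal, val_bot]

theorem subst_subst {Z : Type*} (t : Term S X) (σ : X → Term S Y) (τ : Y → Term S Z) :
    (t.subst σ).subst τ = t.subst (fun x => (σ x).subst τ) := by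
  have key : ∀ (o : List ℕ) (t : Term S X),
      ((t.subst σ).subst τ).val o = (t.subst (fun x => (σ x).subst τ)).val o := by
    intro o
    induction o with
    | nil =>
      intro t
      rcases t.eq_bot_or_var_or_node with rfl | ⟨x, rfl⟩ | ⟨f, s, rfl⟩
      · simp only [bot_subst]
      · simp only [var_subst]
      · simp only [node_subst, node_val_nil]
    | cons i q ih =>
      intro t
      rcases t.eq_bot_or_var_or_node with rfl | ⟨x, rfl⟩ | ⟨f, s, rfl⟩
      · simp only [bot_subst]
      · simp only [var_subst]
      · simp only [node_subst, node_val_cons, ih]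
  ext1
  funext o
  exact key o t

theorem subst_val_op {t : Term S X} {o : List ℕ} {f : S.Op} (σ : X → Term S Y)
    (h : t.val o = some (Sum.inl f)) : (t.subst σ).val o = some (Sum.inl f) := by
  induction o generalizing t with
  | nil =>
    rcases t.eq_bot_or_var_or_node with rfl | ⟨x, rfl⟩ | ⟨f', s, rfl⟩
    · cases h
    · cases h
    · cases h
      rw [node_subst, node_val_nil]
  | cons i q ih =>
    rcases t.eq_bot_or_var_or_node with rfl | ⟨x, rfl⟩ | ⟨f', s, rfl⟩
    · cases h
    · cases h
    · rw [node_subst, node_val_cons]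
      rw [node_val_cons] at h
      split_ifs with hi
      · rw [dif_pos hi] at h
        exact ih h
      · simp [hi] at h

theorem subst_sub_var {t : Term S X} {o : List ℕ} {x : X} (σ : X → Term S Y)
    (h : t.val o = some (Sum.inr x)) : (t.subst σ).sub o = σ x := by
  induction o generalizing t with
  | nil =>
    rcases t.eq_bot_or_var_or_node with rfl | ⟨x, rfl⟩ | ⟨f', s, rfl⟩
    · cases h
    · cases h
      rw [var_subst, sub_nil]
    · cases h
  | cons i q ih =>
    rcases t.eq_bot_or_var_or_node with rfl | ⟨x, rfl⟩ | ⟨f', s, rfl⟩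
    · cases h
    · cases h
    · rw [node_val_cons] at h
      by_cases hi : i < S.arity f'
      · rw [dif_pos hi] at h
        rw [node_subst, ← ih h]
        ext1
        funext r
        rw [val_sub, val_sub, List.cons_append, node_val_cons, dif_pos hi]
      · simp [hi] at h

/-- The value of `t σ` at `o` stems from an operator of `t`, or from a variable of `t` at a prefix
of `o`, or else it is undefined independently of `σ`. -/
theorem subst_val_cases (t : Term S X) (o : List ℕ) :
    (∃ f, t.val o = some (Sum.inl f)) ∨
    (∃ a q x, o = a ++ q ∧ t.val a = some (Sum.inr x)) ∨
    ∀ {Y : Type z} (σ : X → Term S Y), (t.subst σ).val o = none := by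
  induction o generalizing t with
  | nil =>
    rcases t.eq_bot_or_var_or_node with rfl | ⟨x, rfl⟩ | ⟨f', s, rfl⟩
    · right; right
      intro Y σ
      rw [bot_subst, val_bot]
    · exact Or.inr (Or.inl ⟨[], [], x, rfl, rfl⟩)
    · exact Or.inl ⟨f', rfl⟩
  | cons i q ih =>
    rcases t.eq_bot_or_var_or_node with rfl | ⟨x, rfl⟩ | ⟨f', s, rfl⟩
    · right; right
      intro Y σ
      rw [bot_subst, val_bot]
    · exact Or.inr (Or.inl ⟨[], i :: q, x, rfl, rfl⟩)
    · by_cases hi : i < S.arity f'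
      · rcases ih (s ⟨i, hi⟩) with ⟨f, hf⟩ | ⟨a, r, x, rfl, hx⟩ | h
        · left
          exact ⟨f, by rw [node_val_cons, dif_pos hi, hf]⟩
        · right; left
          exact ⟨i :: a, r, x, rfl, by rw [node_val_cons, dif_pos hi, hx]⟩
        · right; right
          intro Y σ
          rw [node_subst, node_val_cons, dif_pos hi]
          exact h σ
      · right; right
        intro Y σ
        rw [node_subst, node_val_cons, dif_neg hi]

theorem subst_val_var {t : Term S X} {a : List ℕ} {x : X} (σ : X → Term S Y) (q : List ℕ)
    (h : t.val a = some (Sum.inr x)) : (t.subst σ).val (a ++ q) = (σ x).val q := by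
  rw [← subst_sub_var σ h, val_sub]

theorem subst_le_subst (t : Term S X) {σ τ : X → Term S Y} (h : ∀ x, σ x ≤ τ x) :
    t.subst σ ≤ t.subst τ := by
  intro o ho
  rcases t.subst_val_cases o with ⟨f, hf⟩ | ⟨a, q, x, rfl, hx⟩ | hn
  · rw [subst_val_op _ hf, subst_val_op _ hf]
  · rw [subst_val_var _ _ hx] at ho
    rw [subst_val_var _ _ hx, subst_val_var _ _ hx, h x q ho]
  · exact absurd (hn σ) ho

end Term

namespace TermGraph

variable {S : Signature.{v}}

theorem follow_nil (G : TermGraph.{u, v} S) (n : G.Node) : G.follow n [] = some n := by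
  simp [follow]

theorem follow_cons_none {G : TermGraph.{u, v} S} {n : G.Node} (h : G.data n = none) (i : ℕ)
    (o : List ℕ) : G.follow n (i :: o) = none := by
  simp [follow, h]

theorem follow_cons_some {G : TermGraph.{u, v} S} {n : G.Node} {f : S.Op}
    {s : Fin (S.arity f) → G.Node} (h : G.data n = some ⟨f, s⟩) (i : ℕ) (o : List ℕ) :
    G.follow n (i :: o) = if hi : i < S.arity f then G.follow (s ⟨i, hi⟩) o else none := by
  simp [follow, h]

theorem follow_append (G : TermGraph.{u, v} S) (n : G.Node) (o q : List ℕ) :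
    G.follow n (o ++ q) = (G.follow n o).bind (fun m => G.follow m q) := by
  induction o generalizing n with
  | nil => simp [follow_nil]
  | cons i o ih =>
    rw [List.cons_append]
    rcases h : G.data n with _ | ⟨f, s⟩
    · simp [follow_cons_none h]
    · rw [follow_cons_some h, follow_cons_some h]
      split_ifs
      · exact ih _
      · rfl

theorem unravel_of_data_none {G : TermGraph.{u, v} S} {n : G.Node} (h : G.data n = none) :
    G.unravel n = Term.var ⟨n, h⟩ := by
  ext1
  funext o
  rcases o with _ | ⟨i, q⟩
  · simp [unravel, follow_nil, symbol_inr h, Term.var]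
  · simp [unravel, follow_cons_none h, Term.var]

theorem unravel_of_data_some {G : TermGraph.{u, v} S} {n : G.Node} {f : S.Op}
    {s : Fin (S.arity f) → G.Node} (h : G.data n = some ⟨f, s⟩) :
    G.unravel n = Term.node f (fun i => G.unravel (s i)) := by
  ext1
  funext o
  rcases o with _ | ⟨i, q⟩
  · simp [unravel, follow_nil, symbol_inl h, Term.node_val_nil]
  · simp only [unravel, follow_cons_some h, Term.node_val_cons]
    split_ifs <;> rfl

theorem unravel_sub {G : TermGraph.{u, v} S} {n m : G.Node} {o : List ℕ}
    (h : G.follow n o = some m) : (G.unravel n).sub o = G.unravel m := by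
  ext1
  funext q
  simp [Term.val_sub, unravel, follow_append, h]

theorem map_data_nodeMap {G H : TermGraph.{u, v} S} (a : G ⟶ H) {n : G.Node} {f : S.Op}
    {s : Fin (S.arity f) → G.Node} (h : G.data n = some ⟨f, s⟩) :
    H.data (nodeMap a n) = some ⟨f, nodeMap a ∘ s⟩ :=
  Hom.map_data a n f s h

/-- Along a morphism `a : L ⟶ G`, unravelings in `G` are instances of unravelings in `L`. -/
theorem unravel_nodeMap_subst {L G : TermGraph.{u, v} S} {Y : Type z} (a : L ⟶ G)
    (φ : G.Var → Term S Y) (m : L.Node) :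
    (G.unravel (nodeMap a m)).subst φ =
      (L.unravel m).subst (fun x => (G.unravel (nodeMap a x.1)).subst φ) := by
  have key : ∀ (o : List ℕ) (m : L.Node), ((G.unravel (nodeMap a m)).subst φ).val o =
      ((L.unravel m).subst (fun x => (G.unravel (nodeMap a x.1)).subst φ)).val o := by
    intro o
    induction o with
    | nil =>
      intro m
      rcases h : L.data m with _ | ⟨f, s⟩
      · rw [unravel_of_data_none h, Term.var_subst]
      · rw [unravel_of_data_some h, unravel_of_data_some (map_data_nodeMap a h),
          Term.node_subst, Term.node_subst]
        rfl
    | cons i q ih =>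
      intro m
      rcases h : L.data m with _ | ⟨f, s⟩
      · rw [unravel_of_data_none h, Term.var_subst]
      · rw [unravel_of_data_some h, unravel_of_data_some (map_data_nodeMap a h),
          Term.node_subst, Term.node_subst, Term.node_val_cons, Term.node_val_cons]
        split_ifs with hi
        · exact ih _
        · rfl
  ext1
  funext o
  exact key o m

end TermGraph

/-! ### Complete developments inside a linear context -/

section Development

variable {S : Signature.{v}} {X : Type w} {Y : Type z}

/-- The redexes `(o ++ q, R)`, for `(q, R)` in `Φ`. -/
def shift (o : List ℕ) (Φ : Set (List ℕ × RewriteRule S X)) : Set (List ℕ × RewriteRule S X) :=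
  (fun Δ => (o ++ Δ.1, Δ.2)) '' Φ

theorem mem_shift {o : List ℕ} {Φ : Set (List ℕ × RewriteRule S X)}
    {Δ : List ℕ × RewriteRule S X} :
    Δ ∈ shift o Φ ↔ ∃ q, Δ.1 = o ++ q ∧ (q, Δ.2) ∈ Φ := by
  constructor
  · rintro ⟨Δ', h, rfl⟩
    exact ⟨Δ'.1, rfl, h⟩
  · rintro ⟨q, hq, h⟩
    exact ⟨(q, Δ.2), h, Prod.ext hq.symm rfl⟩

theorem residuals_shift (o : List ℕ) (Δ Δ' : List ℕ × RewriteRule S X) :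
    residuals (o ++ Δ.1, Δ.2) (o ++ Δ'.1, Δ'.2) = shift o (residuals Δ Δ') := by
  obtain ⟨p, R⟩ := Δ
  obtain ⟨p', R'⟩ := Δ'
  ext ⟨w, R''⟩
  rw [mem_shift]
  simp only [residuals, Set.mem_ofPred_eq, Prod.mk.injEq, ne_eq, List.append_cancel_left_eq,
    List.prefix_append_right_inj, List.append_assoc]
  constructor
  · rintro (⟨h1, h2, rfl, rfl⟩ | ⟨a, b, q, x, h1, h2, h3, rfl, rfl⟩)
    · exact ⟨p, rfl, Or.inl ⟨h1, h2, rfl, rfl⟩⟩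
    · exact ⟨_, rfl, Or.inr ⟨a, b, q, x, h1, h2, h3, rfl, rfl⟩⟩
  · rintro ⟨q, rfl, ⟨h1, h2, rfl, rfl⟩ | ⟨a, b, q, x, h1, h2, h3, rfl, rfl⟩⟩
    · exact Or.inl ⟨h1, h2, rfl, rfl⟩
    · exact Or.inr ⟨a, b, q, x, h1, h2, h3, rfl, rfl⟩

/-- A redex that is not below `Δ'` is its own residual by `Δ'`. -/
theorem residuals_of_not_prefix {Δ Δ' : List ℕ × RewriteRule S X} (h : ¬ Δ'.1 <+: Δ.1) :
    residuals Δ Δ' = {Δ} := by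
  ext Δ''
  simp only [residuals, Set.mem_ofPred_eq, Set.mem_singleton_iff]
  constructor
  · rintro (⟨-, -, h1⟩ | ⟨a, b, q, x, h1, -⟩)
    · exact h1
    · exact absurd ⟨a ++ q, by rw [h1, List.append_assoc]⟩ h
  · rintro rfl
    refine Or.inl ⟨?_, fun h1 => h h1.1, rfl⟩
    rintro rfl
    exact h (List.prefix_refl _)

theorem residualSet_shift_union {o : List ℕ} {Ψ Θ : Set (List ℕ × RewriteRule S X)}
    (Δ : List ℕ × RewriteRule S X) (hΘ : ∀ θ ∈ Θ, ¬ o <+: θ.1) :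
    residualSet (shift o Ψ ∪ Θ) (o ++ Δ.1, Δ.2) = shift o (residualSet Ψ Δ) ∪ Θ := by
  ext Δ''
  simp only [residualSet, Set.mem_iUnion, Set.mem_union, exists_prop]
  constructor
  · rintro ⟨Δ', ⟨ψ, hψ, rfl⟩ | hθ, h⟩
    · left
      have h' : Δ'' ∈ residuals (o ++ ψ.1, ψ.2) (o ++ Δ.1, Δ.2) := h
      rw [residuals_shift] at h'
      obtain ⟨q, hq, h'⟩ := mem_shift.1 h'
      exact mem_shift.2 ⟨q, hq, Set.mem_iUnion₂.2 ⟨ψ, hψ, h'⟩⟩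
    · right
      rw [residuals_of_not_prefix (fun hp => hΘ _ hθ ((List.prefix_append _ _).trans hp))] at h
      rwa [Set.mem_singleton_iff.1 h]
  · rintro (h | h)
    · obtain ⟨q, hq, h'⟩ := mem_shift.1 h
      obtain ⟨ψ, hψ, h'⟩ := Set.mem_iUnion₂.1 h'
      refine ⟨(o ++ ψ.1, ψ.2), Or.inl ⟨ψ, hψ, rfl⟩, ?_⟩
      rw [residuals_shift]
      exact mem_shift.2 ⟨q, hq, h'⟩
    · refine ⟨Δ'', Or.inr h, ?_⟩
      rw [residuals_of_not_prefix (fun hp => hΘ _ h ((List.prefix_append _ _).trans hp))]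
      rfl

/-- A complete development inside the subterm at `o`, followed by one of redexes that do not lie
below `o`. -/
theorem CompleteDevelopment.shift_union {o : List ℕ} {Ψ Θ : Set (List ℕ × RewriteRule S X)}
    {s s' : Term S Y} (h : CompleteDevelopment Ψ s s') (hΘ : ∀ θ ∈ Θ, ¬ o <+: θ.1)
    {t t' t'' : Term S Y} (hs : t.sub o = s) (hs' : t'.sub o = s')
    (hoff : ∀ q, ¬ o <+: q → t.val q = t'.val q) (h' : CompleteDevelopment Θ t' t'') :
    CompleteDevelopment (shift o Ψ ∪ Θ) t t'' := by
  induction h generalizing t with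
  | nil s =>
    have : t = t' := by
      ext1
      funext q
      by_cases hq : o <+: q
      · obtain ⟨r, rfl⟩ := hq
        rw [← Term.val_sub, ← Term.val_sub, hs, hs']
      · exact hoff q hq
    rw [this]
    simpa [shift] using h'
  | @cons Ψ Δ s s₁ s' hΔ hred _ ih =>
    obtain ⟨hocc, τ, hτ, rfl⟩ := hred
    have hocc' : o ++ Δ.1 ∈ t.occ := by
      rw [← hs] at hocc
      exact hocc
    refine CompleteDevelopment.cons (Δ := (o ++ Δ.1, Δ.2)) (Or.inl ⟨Δ, hΔ, rfl⟩)
      ⟨hocc', τ, ?_, rfl⟩ ?_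
    · rw [← hτ, ← hs]
      ext1
      funext q
      simp only [Term.val_sub, List.append_assoc]
    · rw [residualSet_shift_union Δ hΘ]
      have h1 : t.val (o ++ Δ.1) ≠ none := hocc'
      refine ih ?_ hs' ?_
      · ext1
        funext q
        subst hs
        simp only [Term.val_sub, Term.replace, List.prefix_append_right_inj, List.length_append]
        congr 2
        rw [← List.drop_drop, List.drop_left]
      · intro q hq
        rw [← hoff q hq]
        simp only [Term.replace]
        rw [if_neg]
        rintro ⟨-, h2⟩
        exact hq ((List.prefix_append _ _).trans h2)

/-- Let each variable `x` of `P` have the single occurrence `pos x`. Complete developments of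
`σ x` to `σ' x` for all `x` combine to a development of `P σ` to `P σ'`, after which redexes that
do not lie below variables of `P` may be developed. -/
theorem CompleteDevelopment.subst_linear {V : Type*} [Finite V] (P : Term S V)
    (pos : V → List ℕ) (hpos : ∀ o x, P.val o = some (Sum.inr x) ↔ o = pos x)
    {σ σ' : V → Term S Y} {Ψ : V → Set (List ℕ × RewriteRule S X)}
    (h : ∀ x, CompleteDevelopment (Ψ x) (σ x) (σ' x))
    {Θ : Set (List ℕ × RewriteRule S X)} (hΘ : ∀ θ ∈ Θ, ∀ x, ¬ pos x <+: θ.1) {t : Term S Y}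
    (h' : CompleteDevelopment Θ (P.subst σ') t) :
    CompleteDevelopment ((⋃ x, shift (pos x) (Ψ x)) ∪ Θ) (P.subst σ) t := by
  classical
  have := Fintype.ofFinite V
  -- Distinct variables have incomparable occurrences.
  have hinc : ∀ x y, pos x <+: pos y → x = y := by
    rintro x y ⟨q, hq⟩
    have hx := (hpos _ x).2 rfl
    have hy := (hpos _ y).2 rfl
    have h1 := Term.subst_val_var (fun v => (Term.var v : Term S V)) q hx
    have h2 := Term.subst_val_var (fun v => (Term.var v : Term S V)) [] hy
    rw [hq] at h1
    rw [List.append_nil, h1] at h2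
    rcases q with _ | ⟨i, q⟩
    · simp [Term.var] at h2
      exact h2
    · simp [Term.var] at h2
  -- The arguments `x` outside of `J` have been developed already.
  have key : ∀ J : Finset V, CompleteDevelopment ((⋃ x ∈ J, shift (pos x) (Ψ x)) ∪ Θ)
      (P.subst (fun x => if x ∈ J then σ x else σ' x)) t := by
    intro J
    induction J using Finset.induction_on with
    | empty => simpa using h'
    | insert x J hx ih =>
      rw [Finset.set_biUnion_insert, Set.union_assoc]
      refine (h x).shift_union ?_ ?_ ?_ ?_ ih
      · rintro θ (hθ | hθ)
        · obtain ⟨y, hy, hθ⟩ := Set.mem_iUnion₂.1 hθ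
          obtain ⟨q, hq, -⟩ := mem_shift.1 hθ
          intro hp
          rw [hq] at hp
          rcases List.prefix_or_prefix_of_prefix hp (List.prefix_append (pos y) q) with h1 | h1
          · exact hx (hinc _ _ h1 ▸ hy)
          · exact hx (hinc _ _ h1 ▸ hy)
        · exact hΘ θ hθ x
      · rw [Term.subst_sub_var _ ((hpos _ x).2 rfl), if_pos (Finset.mem_insert_self _ _)]
      · rw [Term.subst_sub_var _ ((hpos _ x).2 rfl), if_neg hx]
      · intro q hq
        rcases P.subst_val_cases q with ⟨f, hf⟩ | ⟨a, r, y, rfl, hy⟩ | hn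
        · rw [Term.subst_val_op _ hf, Term.subst_val_op _ hf]
        · rw [Term.subst_val_var _ _ hy, Term.subst_val_var _ _ hy]
          have : y ≠ x := by
            rintro rfl
            exact hq ((hpos _ _).1 hy ▸ List.prefix_append _ _)
          simp [this]
        · rw [hn, hn]
  simpa using key Finset.univ

/-- The arguments of an operator can be developed independently of each other. -/
theorem CompleteDevelopment.node {f : S.Op} {s s' : Fin (S.arity f) → Term S Y}
    {Ψ : Fin (S.arity f) → Set (List ℕ × RewriteRule S X)}
    (h : ∀ i, CompleteDevelopment (Ψ i) (s i) (s' i)) :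
    CompleteDevelopment (⋃ i, shift [i.1] (Ψ i)) (Term.node f s) (Term.node f s') := by
  have h1 := CompleteDevelopment.subst_linear (Θ := ∅) (t := Term.node f s')
    (Term.node f (fun i => Term.var i)) (fun i => [i.1]) ?_ h (by simp) ?_
  · simpa [Term.node_subst, Term.var_subst] using h1
  · rintro (_ | ⟨i, q⟩) x
    · simp [Term.node_val_nil]
    · rw [Term.node_val_cons]
      by_cases hi : i < S.arity f
      · rw [dif_pos hi]
        by_cases hq : q = []
        · simp [Term.var, hq, Fin.ext_iff]
        · simp [Term.var, hq]
      · have := x.2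
        simp [hi]
        omega
  · simp only [Term.node_subst, Term.var_subst]
    exact .nil _

/-- Contracting a redex at the root, as a complete development. -/
theorem CompleteDevelopment.root (R : RewriteRule S X) (σ : X → Term S Y) :
    CompleteDevelopment {([], R)} (R.lhs.subst σ) (R.rhs.subst σ) := by
  obtain ⟨f, s, hf⟩ : ∃ f s, R.lhs = Term.node f s := by
    rcases R.lhs.eq_bot_or_var_or_node with h | ⟨x, h⟩ | h
    · exact absurd (by rw [h, Term.val_bot]) R.lhs_total.1
    · exact absurd h (R.lhs_ne_var x)
    · exact h
  have hocc : [] ∈ (R.lhs.subst σ).occ := by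
    simp [Term.occ, hf, Term.node_subst, Term.node_val_nil]
  refine .cons (Set.mem_singleton _) ⟨hocc, σ, rfl, rfl⟩ ?_
  rw [Term.replace_nil hocc]
  convert CompleteDevelopment.nil _
  rw [Set.eq_empty_iff_forall_notMem]
  intro Δ hΔ
  simp only [residualSet, Set.mem_singleton_iff, Set.iUnion_iUnion_eq_left] at hΔ
  rcases hΔ with ⟨h, -⟩ | ⟨a, b, q, x, h, h', -⟩
  · exact h rfl
  · have ha : a = [] := by simp at h; exact h.1
    rw [ha, hf, Term.node_val_nil] at h'
    cases h'

end Development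

/-! ### The pushouts of a direct derivation -/

namespace TermGraph

variable {S : Signature.{v}}

theorem hom_ext {G H : TermGraph.{u, v} S} {a b : G ⟶ H} (h : ∀ n, nodeMap a n = nodeMap b n) :
    a = b :=
  Hom.ext (funext h)

theorem nodeMap_congr {G H : TermGraph.{u, v} S} {a b : G ⟶ H} (h : a = b) (n : G.Node) :
    nodeMap a n = nodeMap b n := by rw [h]

theorem erase_data_self (G : TermGraph.{u, v} S) (m : G.Node) : (G.erase m).data m = none := by
  classical
  simp [erase]

theorem erase_data_of_ne (G : TermGraph.{u, v} S) {m n : G.Node} (h : n ≠ m) :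
    (G.erase m).data n = G.data n := by
  classical
  simp [erase, h]

theorem symbol_eq_inr {G : TermGraph.{u, v} S} {n : G.Node} {x : G.Var}
    (h : G.symbol n = Sum.inr x) : n = x.1 := by
  rcases hn : G.data n with _ | ⟨f, s⟩
  · rw [symbol_inr hn] at h
    cases h
    rfl
  · rw [symbol_inl hn] at h
    cases h

end TermGraph

namespace EvaluationRule

open TermGraph

variable {S : Signature.{v}} (p : EvaluationRule.{u, v} S)

theorem varInv_spec (ρ : p.R.Var) : nodeMap p.r (p.varInv ρ).1 = ρ.1 :=
  (Classical.choose_spec (p.bijOn_var.surjOn ρ.2)).2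

theorem exists_var {ρ : p.R.Node} (h : p.R.data ρ = none) :
    ∃ x : p.L.Var, nodeMap p.r x.1 = ρ :=
  ⟨p.varInv ⟨ρ, h⟩, p.varInv_spec _⟩

theorem data_r_var (x : p.L.Var) : p.R.data (nodeMap p.r x.1) = none :=
  p.bijOn_var.mapsTo x.2

theorem varInv_r (x : p.L.Var) (h : p.R.data (nodeMap p.r x.1) = none) :
    p.varInv ⟨nodeMap p.r x.1, h⟩ = x :=
  Subtype.ext (p.bijOn_var.injOn (p.varInv _).2 x.2 (p.varInv_spec _))

variable {p} {G : TermGraph.{u, v} S}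

theorem ne_of_data_none (g : p.L ⟶ G) {n : G.Node} (h : G.data n = none) :
    n ≠ nodeMap g p.root := by
  rintro rfl
  obtain ⟨⟨f, s⟩, hd⟩ := Option.ne_none_iff_exists'.1 p.root_nonempty
  rw [map_data_nodeMap g hd] at h
  cases h

/-- If another operator node than the root of `L` were mapped to the image of the root, the
unraveling of `G` at this image would be a common instance of `U[p].lhs` and a proper subterm.
The variables of `G` are sent to `⊥` here, in order to get terms over the variables of `L`. -/
theorem NonSelfOverlapping.eq_root (hp : p.NonSelfOverlapping) (g : p.L ⟶ G) {m : p.L.Node}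
    (hm : p.L.data m ≠ none) (h : nodeMap g m = nodeMap g p.root) : m = p.root := by
  by_contra hne
  obtain ⟨⟨f, s⟩, hd⟩ := Option.ne_none_iff_exists'.1 hm
  obtain ⟨o, ho, -⟩ := p.tree m
  refine hp ⟨o, f, ?_, ?_, fun x => (G.unravel (nodeMap g x.1)).subst (fun _ => ⊥),
    fun x => (G.unravel (nodeMap g x.1)).subst (fun _ => ⊥), ?_⟩
  · rintro rfl
    rw [follow_nil] at ho
    exact hne (Option.some.inj ho).symm
  · change (p.L.follow p.root o).map p.L.symbol = _
    rw [ho, Option.map_some, symbol_inl hd]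
  · change (p.L.unravel p.root).subst _ = ((p.L.unravel p.root).sub o).subst _
    rw [unravel_sub ho, ← unravel_nodeMap_subst, ← unravel_nodeMap_subst, h]

/-- The morphism from the interface to the context graph that has the same action on nodes as the
occurrence `g`; it exists since only the root of `L` loses its label. -/
noncomputable def contextHom (hp : p.NonSelfOverlapping) (g : p.L ⟶ G) :
    p.K ⟶ G.erase (nodeMap g p.root) :=
  (⟨fun n => nodeMap (G := p.L) (H := G) g n, fun n f s h => by
    have hd := erase_data h
    have hn : n ≠ p.root := by
      rintro rfl
      rw [erase_data_self] at h
      cases h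
    rw [erase_data_of_ne]
    · exact map_data_nodeMap g hd
    · exact fun h' => hn (hp.eq_root g (by simp [hd]) h')⟩ :
    Hom p.K (G.erase (nodeMap g p.root)))

theorem isPushout_left (hp : p.NonSelfOverlapping) (g : p.L ⟶ G) :
    IsPushout p.l (contextHom hp g) g (G.eraseHom (nodeMap g p.root)) := by
  refine ⟨⟨hom_ext fun _ => rfl⟩, ⟨Limits.PushoutCocone.IsColimit.mk _
    (fun c => (⟨fun n => nodeMap (G := G.erase (nodeMap g p.root)) c.inr n, ?_⟩ :
      Hom G c.pt)) ?_ ?_ ?_⟩⟩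
  · intro n f s h
    by_cases hn : n = nodeMap g p.root
    · subst hn
      obtain ⟨⟨f', s'⟩, hd⟩ := Option.ne_none_iff_exists'.1 p.root_nonempty
      have h1 := map_data_nodeMap g hd
      rw [h] at h1
      cases h1
      have hc : ∀ m, nodeMap c.inl m =
        nodeMap (G := G.erase (nodeMap g p.root)) c.inr
          (nodeMap (G := p.L) (H := G) g m) := fun m =>
        (nodeMap_congr c.condition m :)
      rw [← hc, map_data_nodeMap c.inl hd]
      congr 2
      funext i
      exact hc _
    · exact map_data_nodeMap c.inr (by rwa [erase_data_of_ne _ hn])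
  · intro c
    exact hom_ext fun n => (nodeMap_congr c.condition.symm n :)
  · intro c
    rfl
  · intro c m _ h2
    exact hom_ext fun n => (nodeMap_congr h2 n :)

variable (p)

/-- The identifications `r m ~ g m`, for nodes `m` of the interface, in the pushout of `p.r` and
`contextHom hp g`. -/
inductive Glue (g : p.L ⟶ G) : p.R.Node ⊕ G.Node → p.R.Node ⊕ G.Node → Prop
  | mk (m : p.L.Node) : Glue g (Sum.inl (nodeMap p.r m)) (Sum.inr (nodeMap g m))

variable {p}

/-- The nodes of the pushout of `p.r` and `contextHom hp g`. -/
abbrev GlueQuot (g : p.L ⟶ G) := Quot (p.Glue g)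

/-- What a node of the pushout may carry: label and successors, or the variable node of `G` it is
the track of; `none` is for variable nodes that are no tracks of variable nodes. -/
abbrev Content (g : p.L ⟶ G) :=
  Option (((f : S.Op) × (Fin (S.arity f) → GlueQuot g)) ⊕ G.Var)

/-- The content of the node `n` of `G`, disregarding that the root of the redex is erased. -/
def contextContent (g : p.L ⟶ G) (n : G.Node) : Content g :=
  match h : G.data n with
  | none => some (Sum.inr ⟨n, h⟩)
  | some ⟨f, s⟩ => some (Sum.inl ⟨f, fun i => Quot.mk _ (Sum.inr (s i))⟩)

theorem contextContent_none {g : p.L ⟶ G} {n : G.Node} (h : G.data n = none) :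
    contextContent g n = some (Sum.inr ⟨n, h⟩) := by
  unfold contextContent
  split
  · rfl
  · rename_i h'
    rw [h] at h'
    cases h'

theorem contextContent_some {g : p.L ⟶ G} {n : G.Node} {f : S.Op}
    {s : Fin (S.arity f) → G.Node} (h : G.data n = some ⟨f, s⟩) :
    contextContent g n = some (Sum.inl ⟨f, fun i => Quot.mk _ (Sum.inr (s i))⟩) := by
  unfold contextContent
  split
  · rename_i h'
    rw [h] at h'
    cases h'
  · rename_i h'
    rw [h] at h'
    cases h'
    rfl

open Classical in
/-- The content that the redex root gets from the node `ρ` of `R` to which the root of `L` is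
mapped. If the rule collapses to a variable matched by the redex root itself, the root becomes a
variable node without origin. -/
noncomputable def rootContent (g : p.L ⟶ G) (ρ : p.R.Node) : Content g :=
  match h : p.R.data ρ with
  | some ⟨f, s⟩ => some (Sum.inl ⟨f, fun i => Quot.mk _ (Sum.inl (s i))⟩)
  | none =>
    if nodeMap g (p.varInv ⟨ρ, h⟩).1 = nodeMap g p.root then none
    else contextContent g (nodeMap g (p.varInv ⟨ρ, h⟩).1)

theorem rootContent_some {g : p.L ⟶ G} {ρ : p.R.Node} {f : S.Op}
    {s : Fin (S.arity f) → p.R.Node} (h : p.R.data ρ = some ⟨f, s⟩) :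
    rootContent g ρ = some (Sum.inl ⟨f, fun i => Quot.mk _ (Sum.inl (s i))⟩) := by
  unfold rootContent
  split
  · rename_i h'
    rw [h] at h'
    cases h'
    rfl
  · rename_i h'
    rw [h] at h'
    cases h'

open Classical in
theorem rootContent_var {g : p.L ⟶ G} (x : p.L.Var) :
    rootContent g (nodeMap p.r x.1) =
      if nodeMap g x.1 = nodeMap g p.root then none else contextContent g (nodeMap g x.1) := by
  unfold rootContent
  split
  · rename_i h'
    rw [p.data_r_var] at h'
    cases h'
  · rw [varInv_r]

open Classical in
/-- The content of a node of the context graph. -/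
noncomputable def erasedContent (g : p.L ⟶ G) (n : G.Node) : Content g :=
  if n = nodeMap g p.root then rootContent g (nodeMap p.r p.root) else contextContent g n

/-- The content of a node of `R`: a variable node inherits it from the node of `G` that matches the
corresponding variable node of `L`. -/
noncomputable def rhsContent (g : p.L ⟶ G) (ρ : p.R.Node) : Content g :=
  match h : p.R.data ρ with
  | some ⟨f, s⟩ => some (Sum.inl ⟨f, fun i => Quot.mk _ (Sum.inl (s i))⟩)
  | none => erasedContent g (nodeMap g (p.varInv ⟨ρ, h⟩).1)

theorem rhsContent_some {g : p.L ⟶ G} {ρ : p.R.Node} {f : S.Op}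
    {s : Fin (S.arity f) → p.R.Node} (h : p.R.data ρ = some ⟨f, s⟩) :
    rhsContent g ρ = some (Sum.inl ⟨f, fun i => Quot.mk _ (Sum.inl (s i))⟩) := by
  unfold rhsContent
  split
  · rename_i h'
    rw [h] at h'
    cases h'
    rfl
  · rename_i h'
    rw [h] at h'
    cases h'

theorem rhsContent_var {g : p.L ⟶ G} (x : p.L.Var) :
    rhsContent g (nodeMap p.r x.1) = erasedContent g (nodeMap g x.1) := by
  unfold rhsContent
  split
  · rename_i h'
    rw [p.data_r_var] at h'
    cases h'
  · rw [varInv_r]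

theorem erasedContent_root (g : p.L ⟶ G) :
    erasedContent g (nodeMap g p.root) = rootContent g (nodeMap p.r p.root) := if_pos rfl

theorem erasedContent_of_ne {g : p.L ⟶ G} {n : G.Node} (h : n ≠ nodeMap g p.root) :
    erasedContent g n = contextContent g n := if_neg h

/-- Content is compatible with gluing; this is where non-self-overlapping is essential, since
otherwise an operator node could be glued to the redex root. -/
theorem rhsContent_r (hp : p.NonSelfOverlapping) (g : p.L ⟶ G) (m : p.L.Node) :
    rhsContent g (nodeMap p.r m) = erasedContent g (nodeMap g m) := by
  rcases h : p.L.data m with _ | ⟨f, s⟩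
  · exact rhsContent_var ⟨m, h⟩
  · by_cases hm : m = p.root
    · subst hm
      rw [erasedContent_root]
      rcases hr : p.R.data (nodeMap p.r p.root) with _ | ⟨f', s'⟩
      · obtain ⟨x, hxr⟩ := p.exists_var hr
        rw [← hxr, rootContent_var x, rhsContent_var x]
        split_ifs with h'
        · rw [h', erasedContent_root, ← hxr, rootContent_var x, if_pos h']
        · rw [erasedContent_of_ne h']
      · rw [rhsContent_some hr, rootContent_some hr]
    · have h' : nodeMap g m ≠ nodeMap g p.root := fun h' => hm (hp.eq_root g (by simp [h]) h')
      have h1 : p.K.data m = some ⟨f, s⟩ := by rwa [erase_data_of_ne _ hm]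
      rw [erasedContent_of_ne h', contextContent_some (map_data_nodeMap g h),
        rhsContent_some (map_data_nodeMap p.r h1)]
      congr 3
      funext i
      exact Quot.sound (Glue.mk (s i))

/-- The content of a node of the pushout. -/
noncomputable def content (hp : p.NonSelfOverlapping) (g : p.L ⟶ G) : GlueQuot g → Content g :=
  Quot.lift (Sum.elim (rhsContent g) (erasedContent g)) (by
    rintro _ _ ⟨m⟩
    exact rhsContent_r hp g m)

/-- The pushout of `p.r` and `contextHom hp g`. -/
noncomputable def result (hp : p.NonSelfOverlapping) (g : p.L ⟶ G) : TermGraph.{u, v} S where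
  Node := GlueQuot g
  finite_node := by
    have := p.R.finite_node
    have := G.finite_node
    infer_instance
  data c := (content hp g c).bind (Sum.elim some (fun _ => none))

/-- The morphism from the right-hand side to the pushout. -/
noncomputable def resultInl (hp : p.NonSelfOverlapping) (g : p.L ⟶ G) : p.R ⟶ result hp g :=
  (⟨fun ρ => Quot.mk _ (Sum.inl ρ), fun ρ f s h => by
    change (rhsContent g ρ).bind _ = _
    rw [rhsContent_some h]
    rfl⟩ : Hom p.R (result hp g))

/-- The morphism from the context graph to the pushout. -/
noncomputable def resultInr (hp : p.NonSelfOverlapping) (g : p.L ⟶ G) :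
    G.erase (nodeMap g p.root) ⟶ result hp g :=
  (⟨fun n => Quot.mk _ (Sum.inr n), fun n f s h => by
    have hn : n ≠ nodeMap g p.root := by
      rintro rfl
      rw [erase_data_self] at h
      cases h
    have h1 : erasedContent g n = contextContent g n := erasedContent_of_ne hn
    exact (congrArg (Option.bind · (Sum.elim some (fun _ => none)))
      (h1.trans (contextContent_some (erase_data h))) :)⟩ :
    Hom (G.erase (nodeMap g p.root)) (result hp g))

/-- The universal property of the pushout; `w` is the action on nodes of a morphism from the context
graph. -/
noncomputable def resultDesc (hp : p.NonSelfOverlapping) (g : p.L ⟶ G) {I : TermGraph.{u, v} S}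
    (a : p.R ⟶ I) (w : G.Node → I.Node)
    (hc : ∀ m : p.L.Node, nodeMap a (nodeMap p.r m) = w (nodeMap g m))
    (hw : ∀ n f s, n ≠ nodeMap g p.root → G.data n = some ⟨f, s⟩ →
      I.data (w n) = some ⟨f, w ∘ s⟩) : result hp g ⟶ I :=
  (⟨Quot.lift (Sum.elim (nodeMap a) w) (by rintro _ _ ⟨m⟩; exact hc m), by
    have hG : ∀ n f s, n ≠ nodeMap g p.root →
        (contextContent g n).bind (Sum.elim some (fun _ => none)) = some ⟨f, s⟩ →
        I.data (w n) = some ⟨f, fun i => Quot.lift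
          (Sum.elim (nodeMap a) w) (by rintro _ _ ⟨m⟩; exact hc m) (s i)⟩ := by
      intro n f s hn h
      rcases hd : G.data n with _ | ⟨f', s'⟩
      · rw [contextContent_none hd] at h
        cases h
      · rw [contextContent_some hd] at h
        cases h
        exact hw _ _ _ hn hd
    have hE : ∀ n f s, (erasedContent g n).bind (Sum.elim some (fun _ => none)) = some ⟨f, s⟩ →
        I.data (w n) = some ⟨f, fun i => Quot.lift
          (Sum.elim (nodeMap a) w) (by rintro _ _ ⟨m⟩; exact hc m) (s i)⟩ := by
      intro n f s h
      by_cases hn : n = nodeMap g p.root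
      · subst hn
        rw [erasedContent_root] at h
        rw [← hc]
        rcases hr : p.R.data (nodeMap p.r p.root) with _ | ⟨f', s'⟩
        · obtain ⟨x, hxr⟩ := p.exists_var hr
          rw [← hxr, rootContent_var x] at h
          rw [← hxr, hc]
          split_ifs at h with h'
          · cases h
          · exact hG _ _ _ h' h
        · rw [rootContent_some hr] at h
          cases h
          exact map_data_nodeMap a hr
      · rw [erasedContent_of_ne hn] at h
        exact hG _ _ _ hn h
    rintro ⟨ρ | n⟩ f s h
    · change (rhsContent g ρ).bind _ = _ at h
      rcases hr : p.R.data ρ with _ | ⟨f', s'⟩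
      · obtain ⟨x, rfl⟩ := p.exists_var hr
        rw [rhsContent_var x] at h
        change I.data (nodeMap a (nodeMap p.r x.1)) = _
        rw [hc]
        exact hE _ _ _ h
      · rw [rhsContent_some hr] at h
        cases h
        exact map_data_nodeMap a hr
    · exact hE _ _ _ h⟩ : Hom (result hp g) I)

theorem isPushout_right (hp : p.NonSelfOverlapping) (g : p.L ⟶ G) :
    IsPushout p.r (contextHom hp g) (resultInl hp g) (resultInr hp g) := by
  refine ⟨⟨hom_ext fun m => Quot.sound (Glue.mk (g := g) m)⟩,
    ⟨Limits.PushoutCocone.IsColimit.mk _ (fun c => resultDesc hp g c.inl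
      (nodeMap (G := G.erase (nodeMap g p.root)) c.inr)
      (fun m => (nodeMap_congr c.condition m :)) ?_) ?_ ?_ ?_⟩⟩
  · intro n f s hn h
    exact map_data_nodeMap c.inr (by rwa [erase_data_of_ne _ hn])
  · intro c
    rfl
  · intro c
    rfl
  · intro c m h1 h2
    refine hom_ext ?_
    rintro ⟨ρ | n⟩
    · exact (nodeMap_congr h1 ρ :)
    · exact (nodeMap_congr h2 n :)

/-- The direct derivation by `p` at `g` with the pushouts constructed above. -/
noncomputable def derivation (hp : p.NonSelfOverlapping) (g : p.L ⟶ G) :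
    DirectDerivation p g (result hp g) where
  k := contextHom hp g
  h := resultInl hp g
  b := resultInr hp g
  left := isPushout_left hp g
  right := isPushout_right hp g

end EvaluationRule

namespace DirectDerivation

open TermGraph EvaluationRule

variable {S : Signature.{v}} {p : EvaluationRule.{u, v} S} {G H : TermGraph.{u, v} S}
  {g : p.L ⟶ G} (α : DirectDerivation p g H)

theorem nodeMap_h_r (m : p.L.Node) : nodeMap α.h (nodeMap p.r m) = α.track (nodeMap g m) := by
  have h1 : nodeMap g m = nodeMap α.k m := (nodeMap_congr α.left.w m :)
  rw [h1]
  exact (nodeMap_congr α.right.w m :)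

theorem data_track {n : G.Node} (hn : n ≠ nodeMap g p.root) {f : S.Op}
    {s : Fin (S.arity f) → G.Node} (h : G.data n = some ⟨f, s⟩) :
    H.data (α.track n) = some ⟨f, α.track ∘ s⟩ :=
  map_data_nodeMap α.b (by rwa [erase_data_of_ne _ hn])

/-- By the universal property, `H` maps to the graph `result hp g`, so that its nodes have a
content. -/
theorem exists_content (hp : p.NonSelfOverlapping) : ∃ c : H.Node → Content g,
    (∀ n, c (α.track n) = erasedContent g n) ∧
    ∀ m, (c m).bind (Sum.elim some (fun _ => none)) = none → H.data m = none := by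
  have hk : α.k = contextHom hp g :=
    hom_ext fun m => ((nodeMap_congr α.left.w m :)).symm
  obtain ⟨d, -, hd⟩ := α.right.exists_desc (resultInl hp g) (resultInr hp g)
    (by rw [hk]; exact (isPushout_right hp g).w)
  refine ⟨fun m => content hp g (nodeMap d m), ?_, ?_⟩
  · intro n
    have : nodeMap d (α.track n) = Quot.mk _ (Sum.inr n) :=
      (nodeMap_congr hd n :)
    exact congrArg (content hp g) this
  · intro m hm
    rcases h : H.data m with _ | ⟨f, s⟩
    · rfl
    · have h1 : (content hp g (nodeMap d m)).bind _ = _ := map_data_nodeMap d h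
      rw [hm] at h1
      cases h1

theorem erasedContent_of_data_none {n : G.Node} (h : G.data n = none) :
    erasedContent g n = some (Sum.inr ⟨n, h⟩) := by
  rw [erasedContent_of_ne (ne_of_data_none g h), contextContent_none h]

theorem mapsTo_track (hp : p.NonSelfOverlapping) : Set.MapsTo α.track G.varSet H.varSet := by
  obtain ⟨c, hc, hd⟩ := α.exists_content hp
  intro n hn
  refine hd _ ?_
  rw [hc, erasedContent_of_data_none hn]
  rfl

theorem injOn_track (hp : p.NonSelfOverlapping) : Set.InjOn α.track G.varSet := by
  obtain ⟨c, hc, -⟩ := α.exists_content hp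
  intro n hn n' hn' h
  have h1 := congrArg c h
  rw [hc, hc, erasedContent_of_data_none hn, erasedContent_of_data_none hn'] at h1
  cases h1
  rfl

theorem trackBack_track (hp : p.NonSelfOverlapping) (y : G.Var)
    (h : H.data (α.track y.1) = none) : α.trackBack ⟨α.track y.1, h⟩ = Term.var y := by
  have hx : ∃ y' : G.Var, α.track y'.1 = α.track y.1 := ⟨y, rfl⟩
  rw [trackBack, dif_pos hx]
  exact congrArg Term.var
    (Subtype.ext (α.injOn_track hp (Classical.choose hx).2 y.2 (Classical.choose_spec hx)))

/-- The instance of the unraveling of `H` at the track of `n` in which tracked variable nodes are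
renamed back and all other variable nodes are undefined. -/
noncomputable def trackTerm (n : G.Node) : Term S G.Var :=
  (H.unravel (α.track n)).subst α.trackBack

theorem trackTerm_of_data_none (hp : p.NonSelfOverlapping) {n : G.Node} (h : G.data n = none) :
    α.trackTerm n = Term.var ⟨n, h⟩ := by
  rw [trackTerm, unravel_of_data_none (α.mapsTo_track hp h), Term.var_subst]
  exact α.trackBack_track hp ⟨n, h⟩ _

theorem trackTerm_of_data_some {n : G.Node} (hn : n ≠ nodeMap g p.root) {f : S.Op}
    {s : Fin (S.arity f) → G.Node} (h : G.data n = some ⟨f, s⟩) :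
    α.trackTerm n = Term.node f (fun i => α.trackTerm (s i)) := by
  rw [trackTerm, unravel_of_data_some (α.data_track hn h), Term.node_subst]
  rfl

theorem trackTerm_root : α.trackTerm (nodeMap g p.root) =
    p.unravel.rhs.subst (fun x => α.trackTerm (nodeMap g x.1)) := by
  have h : p.unravel.rhs = (p.R.unravel (nodeMap p.r p.root)).subst
      (fun x => Term.var (p.varInv x)) := rfl
  rw [h, Term.subst_subst, trackTerm, ← nodeMap_h_r, unravel_nodeMap_subst]
  congr 1
  funext ρ
  rw [Term.var_subst, trackTerm, ← nodeMap_h_r, p.varInv_spec]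

/-- If the rule collapses to a variable that is matched by the redex root itself, contraction
leaves an unlabelled loop, whose unraveling is undefined. -/
theorem trackTerm_root_of_cycle (hp : p.NonSelfOverlapping) {x : p.L.Var}
    (hx : p.unravel.rhs.val [] = some (Sum.inr x)) (hg : nodeMap g x.1 = nodeMap g p.root) :
    α.trackTerm (nodeMap g p.root) = ⊥ := by
  have hr : nodeMap p.r p.root = nodeMap p.r x.1 := by
    rcases hd : p.R.data (nodeMap p.r p.root) with _ | ⟨f, s⟩
    · have h1 : p.unravel.rhs = Term.var (p.varInv ⟨_, hd⟩) := by
        change (p.R.unravel (nodeMap p.r p.root)).subst _ = _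
        rw [unravel_of_data_none hd, Term.var_subst]
      rw [h1] at hx
      cases hx
      rw [varInv_spec]
    · have h1 : p.unravel.rhs.val [] = some (Sum.inl f) := by
        change ((p.R.unravel (nodeMap p.r p.root)).subst _).val [] = _
        rw [unravel_of_data_some hd, Term.node_subst, Term.node_val_nil]
      rw [h1] at hx
      cases hx
  have hroot : erasedContent g (nodeMap g p.root) = none := by
    rw [erasedContent_root, hr, rootContent_var, if_pos hg]
  obtain ⟨c, hc, hd⟩ := α.exists_content hp
  have h1 : H.data (α.track (nodeMap g p.root)) = none := hd _ (by rw [hc, hroot]; rfl)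
  rw [trackTerm, unravel_of_data_none h1, Term.var_subst, trackBack, dif_neg]
  rintro ⟨y, hy⟩
  have h2 := congrArg c hy
  rw [hc, hc, hroot, erasedContent_of_data_none y.2] at h2
  cases h2

end DirectDerivation

/-! ### Truncated unravelings and their reducts -/

namespace TermGraph

variable {S : Signature.{v}}

/-- The unraveling of `G` at `n`, cut at all occurrences of the node `e` of length at least `k`. -/
noncomputable def trunc (G : TermGraph.{u, v} S) (e : G.Node) (k : ℕ) (n : G.Node) :
    Term S G.Var where
  val o := open Classical in
    if ∀ q, q <+: o → k ≤ q.length → G.follow n q ≠ some e then (G.unravel n).val o else none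
  closed o i h := by
    classical
    by_cases ho : ∀ q, q <+: o ++ [i] → k ≤ q.length → G.follow n q ≠ some e
    · rw [if_pos ho] at h
      rw [if_pos fun q hq => ho q (hq.trans (List.prefix_append _ _))]
      exact (G.unravel n).closed o i h
    · rw [if_neg ho] at h
      exact absurd rfl h

variable {G : TermGraph.{u, v} S} {e n : G.Node} {k : ℕ}

theorem trunc_val_of_forall {o : List ℕ}
    (h : ∀ q, q <+: o → k ≤ q.length → G.follow n q ≠ some e) :
    (G.trunc e k n).val o = (G.unravel n).val o := if_pos h

theorem trunc_val_of_not {o : List ℕ}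
    (h : ¬ ∀ q, q <+: o → k ≤ q.length → G.follow n q ≠ some e) :
    (G.trunc e k n).val o = none := if_neg h

theorem trunc_val_of_lt {o : List ℕ} (h : o.length < k) :
    (G.trunc e k n).val o = (G.unravel n).val o :=
  trunc_val_of_forall fun _ hq hk => absurd (hk.trans hq.length_le) (by omega)

theorem trunc_val_of_follow {o : List ℕ} (h : G.follow n o = some e) (hk : k ≤ o.length) :
    (G.trunc e k n).val o = none :=
  trunc_val_of_not fun h' => h' o (List.prefix_refl _) hk h

theorem trunc_of_forall (h : ∀ q, k ≤ q.length → G.follow n q ≠ some e) :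
    G.trunc e k n = G.unravel n := by
  ext1
  funext o
  exact trunc_val_of_forall fun q _ => h q

theorem trunc_le_unravel : G.trunc e k n ≤ G.unravel n := by
  intro o ho
  by_cases h : ∀ q, q <+: o → k ≤ q.length → G.follow n q ≠ some e
  · exact (trunc_val_of_forall h).symm
  · exact absurd (trunc_val_of_not h) ho

theorem trunc_mono : Monotone fun k => G.trunc e k n := by
  intro k k' hk o ho
  by_cases h : ∀ q, q <+: o → k ≤ q.length → G.follow n q ≠ some e
  · change (G.trunc e k' n).val o = (G.trunc e k n).val o
    rw [trunc_val_of_forall h, trunc_val_of_forall fun q hq hk' => h q hq (hk.trans hk')]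
  · exact absurd (trunc_val_of_not h) ho

theorem isLUB_range_trunc : IsLUB (Set.range fun k => G.trunc e k n) (G.unravel n) := by
  constructor
  · rintro _ ⟨k, rfl⟩
    exact trunc_le_unravel
  · intro t ht o ho
    have h := ht ⟨o.length + 1, rfl⟩ o (by rwa [trunc_val_of_lt (Nat.lt_succ_self _)])
    rwa [trunc_val_of_lt (Nat.lt_succ_self _)] at h

theorem trunc_zero_self : G.trunc e 0 e = ⊥ := by
  ext1
  funext o
  exact trunc_val_of_not fun h => h [] List.nil_prefix (Nat.zero_le _) (follow_nil G e)

theorem trunc_of_data_none (hn : n = e → 0 < k) (h : G.data n = none) :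
    G.trunc e k n = Term.var ⟨n, h⟩ := by
  rw [← unravel_of_data_none h]
  refine trunc_of_forall fun q hk hq => ?_
  rcases q with _ | ⟨i, q⟩
  · rw [follow_nil] at hq
    have := hn (Option.some.inj hq)
    simp at hk
    omega
  · rw [follow_cons_none h] at hq
    cases hq

theorem trunc_of_data_some (hn : n = e → 0 < k) {f : S.Op} {s : Fin (S.arity f) → G.Node}
    (h : G.data n = some ⟨f, s⟩) :
    G.trunc e k n = Term.node f (fun i => G.trunc e (k - 1) (s i)) := by
  have hnil : k ≤ ([] : List ℕ).length → G.follow n [] ≠ some e := by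
    intro hk hq
    rw [follow_nil] at hq
    have := hn (Option.some.inj hq)
    simp at hk
    omega
  ext1
  funext o
  rcases o with _ | ⟨i, o⟩
  · rw [trunc_val_of_forall, unravel_of_data_some h, Term.node_val_nil, Term.node_val_nil]
    intro q hq
    rw [List.prefix_nil.1 hq]
    exact hnil
  · rw [Term.node_val_cons]
    by_cases hi : i < S.arity f
    · have hfollow : ∀ q, G.follow n (i :: q) = G.follow (s ⟨i, hi⟩) q := fun q => by
        rw [follow_cons_some h, dif_pos hi]
      rw [dif_pos hi]
      by_cases hc : ∀ q, q <+: o → k - 1 ≤ q.length → G.follow (s ⟨i, hi⟩) q ≠ some e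
      · rw [trunc_val_of_forall hc, trunc_val_of_forall, unravel_of_data_some h,
          Term.node_val_cons, dif_pos hi]
        rintro (_ | ⟨j, q⟩) hq hk
        · exact hnil hk
        · obtain ⟨rfl, hq'⟩ := List.cons_prefix_cons.1 hq
          rw [hfollow]
          exact hc q hq' (by simp at hk; omega)
      · rw [trunc_val_of_not hc, trunc_val_of_not]
        intro h'
        refine hc fun q hq hk => ?_
        rw [← hfollow]
        exact h' (i :: q) (List.cons_prefix_cons.2 ⟨rfl, hq⟩) (by simp; omega)
    · rw [dif_neg hi]
      by_contra h'
      have h1 := trunc_le_unravel _ h'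
      rw [← h1, unravel_of_data_some h, Term.node_val_cons, dif_neg hi] at h'
      exact h' rfl

theorem trunc_sub {o : List ℕ} {m : G.Node} (h : G.follow n o = some m) (hk : o.length < k) :
    (G.trunc e k n).sub o = G.trunc e (k - o.length) m := by
  ext1
  funext q
  rw [Term.val_sub]
  have hfollow : ∀ q, G.follow n (o ++ q) = G.follow m q := fun q => by
    rw [follow_append, h, Option.bind_some]
  by_cases hc : ∀ r, r <+: q → k - o.length ≤ r.length → G.follow m r ≠ some e
  · rw [trunc_val_of_forall hc, trunc_val_of_forall, ← Term.val_sub, unravel_sub h]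
    intro r hr hkr
    rcases List.prefix_or_prefix_of_prefix hr (List.prefix_append o q) with hro | ⟨r', rfl⟩
    · have := hro.length_le
      omega
    · rw [hfollow]
      rw [List.length_append] at hkr
      exact hc r' ((List.prefix_append_right_inj _).1 hr) (by omega)
  · rw [trunc_val_of_not hc, trunc_val_of_not]
    intro h'
    refine hc fun r hr hkr => ?_
    rw [← hfollow]
    exact h' (o ++ r) ((List.prefix_append_right_inj _).2 hr) (by rw [List.length_append]; omega)

/-- There are finitely many paths of bounded length from a node. -/
theorem finite_follow_lt (G : TermGraph.{u, v} S) (k : ℕ) (n : G.Node) :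
    {o : List ℕ | G.follow n o ≠ none ∧ o.length < k}.Finite := by
  induction k generalizing n with
  | zero => simp
  | succ k ih =>
    rcases h : G.data n with _ | ⟨f, s⟩
    · refine (Set.finite_singleton []).subset ?_
      rintro (_ | ⟨i, o⟩) ⟨ho, -⟩
      · rfl
      · exact absurd (follow_cons_none h i o) ho
    · refine ((Set.finite_singleton []).union (Set.finite_iUnion fun i : Fin (S.arity f) =>
        (ih (s i)).image (List.cons i.1))).subset ?_
      rintro (_ | ⟨i, o⟩) ⟨ho, hk⟩
      · exact Or.inl rfl
      · right
        rw [follow_cons_some h] at ho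
        by_cases hi : i < S.arity f
        · rw [dif_pos hi] at ho
          exact Set.mem_iUnion.2 ⟨⟨i, hi⟩, o, ⟨ho, by simpa using hk⟩, rfl⟩
        · rw [dif_neg hi] at ho
          exact absurd rfl ho

/-- A path in `G` from the image of a node of `L` has a prefix that is the image of a path to a
variable node of `L`, or is itself the image of a path of `L`. -/
theorem follow_nodeMap_cases {L G : TermGraph.{u, v} S} (a : L ⟶ G) {m : L.Node} {o : List ℕ}
    {n : G.Node} (h : G.follow (nodeMap a m) o = some n) :
    (∃ m', L.follow m o = some m' ∧ nodeMap a m' = n) ∨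
    ∃ (q r : List ℕ) (x : L.Var), o = q ++ r ∧ L.follow m q = some x.1 := by
  induction o generalizing m with
  | nil =>
    rw [follow_nil] at h
    exact Or.inl ⟨m, follow_nil L m, Option.some.inj h⟩
  | cons i o ih =>
    rcases hm : L.data m with _ | ⟨f, s⟩
    · exact Or.inr ⟨[], i :: o, ⟨m, hm⟩, rfl, follow_nil L m⟩
    · rw [follow_cons_some (map_data_nodeMap a hm)] at h
      by_cases hi : i < S.arity f
      · rw [dif_pos hi] at h
        have hfollow : ∀ q, L.follow m (i :: q) = L.follow (s ⟨i, hi⟩) q := fun q => by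
          rw [follow_cons_some hm, dif_pos hi]
        rcases ih h with ⟨m', hm', hn⟩ | ⟨q, r, x, rfl, hx⟩
        · exact Or.inl ⟨m', by rw [hfollow, hm'], hn⟩
        · exact Or.inr ⟨i :: q, r, x, rfl, by rw [hfollow, hx]⟩
      · rw [dif_neg hi] at h
        cases h

theorem follow_nodeMap {L G : TermGraph.{u, v} S} (a : L ⟶ G) {m m' : L.Node} {o : List ℕ}
    (h : L.follow m o = some m') : G.follow (nodeMap a m) o = some (nodeMap a m') := by
  induction o generalizing m with
  | nil =>
    rw [follow_nil] at h ⊢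
    rw [Option.some.inj h]
  | cons i o ih =>
    rcases hm : L.data m with _ | ⟨f, s⟩
    · rw [follow_cons_none hm] at h
      cases h
    · rw [follow_cons_some hm] at h
      rw [follow_cons_some (map_data_nodeMap a hm)]
      by_cases hi : i < S.arity f
      · rw [dif_pos hi] at h ⊢
        exact ih h
      · rw [dif_neg hi] at h
        cases h

end TermGraph

namespace EvaluationRule

open TermGraph

variable {S : Signature.{v}} (p : EvaluationRule.{u, v} S)

/-- The occurrence of the node `m` in the tree `L`. -/
noncomputable def pos (m : p.L.Node) : List ℕ := Classical.choose (p.tree m)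

theorem follow_pos (m : p.L.Node) : p.L.follow p.root (p.pos m) = some m :=
  (Classical.choose_spec (p.tree m)).1

variable {p}

theorem eq_pos {m : p.L.Node} {o : List ℕ} (h : p.L.follow p.root o = some m) : o = p.pos m :=
  (p.tree m).unique h (p.follow_pos m)

theorem lhs_val_eq_var_iff (o : List ℕ) (x : p.L.Var) :
    p.unravel.lhs.val o = some (Sum.inr x) ↔ o = p.pos x.1 := by
  change (p.L.follow p.root o).map p.L.symbol = _ ↔ _
  constructor
  · intro h
    obtain ⟨m, hm, hs⟩ := Option.map_eq_some_iff.1 h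
    rw [symbol_eq_inr hs] at hm
    exact eq_pos hm
  · rintro rfl
    rw [follow_pos, Option.map_some, symbol_inr x.2]

theorem pos_var_ne_nil (x : p.L.Var) : p.pos x.1 ≠ [] := by
  intro h
  have h1 := p.follow_pos x.1
  rw [h, follow_nil] at h1
  exact p.root_nonempty ((congrArg p.L.data (Option.some.inj h1)).trans x.2)

theorem length_pos_var (x : p.L.Var) : 0 < (p.pos x.1).length :=
  List.length_pos_iff.2 (pos_var_ne_nil x)

variable {G : TermGraph.{u, v} S}

theorem follow_root_pos (g : p.L ⟶ G) (m : p.L.Node) :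
    G.follow (nodeMap g p.root) (p.pos m) = some (nodeMap g m) :=
  follow_nodeMap g (p.follow_pos m)

/-- Truncation does not destroy the redexes it leaves, as no inner operator node of `L` matches
the redex root. -/
theorem trunc_root_eq_subst (hp : p.NonSelfOverlapping) (g : p.L ⟶ G) {k : ℕ} (hk : 0 < k) :
    G.trunc (nodeMap g p.root) k (nodeMap g p.root) = p.unravel.lhs.subst
      (fun x => G.trunc (nodeMap g p.root) (k - (p.pos x.1).length) (nodeMap g x.1)) := by
  have key : ∀ (o : List ℕ) (m : p.L.Node),
      (G.trunc (nodeMap g p.root) (k - (p.pos m).length) (nodeMap g m)).val o =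
        ((p.L.unravel m).subst (fun x =>
          G.trunc (nodeMap g p.root) (k - (p.pos x.1).length) (nodeMap g x.1))).val o := by
    intro o
    induction o with
    | nil =>
      intro m
      rcases h : p.L.data m with _ | ⟨f, s⟩
      · rw [unravel_of_data_none h, Term.var_subst]
      · rw [unravel_of_data_some h, trunc_of_data_some _ (map_data_nodeMap g h), Term.node_subst]
        · rfl
        · intro hm
          rw [hp.eq_root g (by simp [h]) hm, ← eq_pos (follow_nil p.L p.root)]
          simpa using hk
    | cons i q ih =>
      intro m
      rcases h : p.L.data m with _ | ⟨f, s⟩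
      · rw [unravel_of_data_none h, Term.var_subst]
      · rw [unravel_of_data_some h, trunc_of_data_some _ (map_data_nodeMap g h), Term.node_subst]
        · rw [Term.node_val_cons, Term.node_val_cons]
          split_ifs with hi
          · rw [← ih]
            have h1 : p.pos m ++ [i] = p.pos (s ⟨i, hi⟩) := by
              refine eq_pos ?_
              rw [follow_append, follow_pos, Option.bind_some, follow_cons_some h, dif_pos hi,
                follow_nil]
            rw [← h1, List.length_append, ← Nat.sub_sub]
            rfl
          · rfl
        · intro hm
          rw [hp.eq_root g (by simp [h]) hm, ← eq_pos (follow_nil p.L p.root)]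
          simpa using hk
  ext1
  funext o
  have h := key o p.root
  rw [← eq_pos (follow_nil p.L p.root)] at h
  exact h

open Classical in
/-- The result of contracting all redexes of `G.trunc e k n`, where `e` is the redex root. -/
noncomputable def reduct (g : p.L ⟶ G) : ℕ → G.Node → Term S G.Var
  | 0, n => G.trunc (nodeMap g p.root) 0 n
  | k + 1, n =>
    if n = nodeMap g p.root then
      p.unravel.rhs.subst (fun x => reduct g (k + 1 - (p.pos x.1).length) (nodeMap g x.1))
    else match h : G.data n with
      | none => Term.var ⟨n, h⟩
      | some ⟨_, s⟩ => Term.node _ (fun i => reduct g k (s i))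
  termination_by k _ => k
  decreasing_by
    · have := length_pos_var x
      omega
    · omega

theorem reduct_zero (g : p.L ⟶ G) (n : G.Node) :
    reduct g 0 n = G.trunc (nodeMap g p.root) 0 n := by
  rw [reduct]

theorem reduct_root (g : p.L ⟶ G) {k : ℕ} (hk : 0 < k) : reduct g k (nodeMap g p.root) =
    p.unravel.rhs.subst (fun x => reduct g (k - (p.pos x.1).length) (nodeMap g x.1)) := by
  obtain ⟨k, rfl⟩ := Nat.exists_eq_succ_of_ne_zero hk.ne'
  rw [reduct, if_pos rfl]

theorem reduct_of_data_none (g : p.L ⟶ G) (k : ℕ) {n : G.Node} (h : G.data n = none) :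
    reduct g k n = Term.var ⟨n, h⟩ := by
  have hn := ne_of_data_none g h
  cases k with
  | zero => rw [reduct_zero, trunc_of_data_none (fun h' => absurd h' hn) h]
  | succ k =>
    rw [reduct, if_neg hn]
    split
    · rfl
    · rename_i h'
      rw [h] at h'
      cases h'

theorem reduct_of_data_some (g : p.L ⟶ G) (k : ℕ) {n : G.Node} (hn : n ≠ nodeMap g p.root)
    {f : S.Op} {s : Fin (S.arity f) → G.Node} (h : G.data n = some ⟨f, s⟩) :
    reduct g k n = Term.node f (fun i => reduct g (k - 1) (s i)) := by
  cases k with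
  | zero =>
    rw [reduct_zero, trunc_of_data_some (fun h' => absurd h' hn) h]
    simp only [reduct_zero, Nat.zero_sub]
  | succ k =>
    rw [reduct, if_neg hn]
    split
    · rename_i h'
      rw [h] at h'
      cases h'
    · rename_i h'
      rw [h] at h'
      cases h'
      rfl

theorem reduct_le_succ (g : p.L ⟶ G) (k : ℕ) (n : G.Node) :
    reduct g k n ≤ reduct g (k + 1) n := by
  induction k using Nat.strong_induction_on generalizing n with
  | _ k ih =>
    by_cases hn : n = nodeMap g p.root
    · subst hn
      rcases Nat.eq_zero_or_pos k with rfl | hk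
      · rw [reduct_zero, trunc_zero_self]
        exact Term.bot_le' _
      · rw [reduct_root g hk, reduct_root g (Nat.add_one_pos k)]
        refine Term.subst_le_subst _ fun x => ?_
        have h1 := length_pos_var x
        rcases Nat.lt_or_ge k (p.pos x.1).length with h2 | h2
        · rw [Nat.sub_eq_zero_of_le h2.le, Nat.sub_eq_zero_of_le h2]
        · rw [Nat.sub_add_comm h2]
          exact ih _ (by omega) _
    · rcases h : G.data n with _ | ⟨f, s⟩
      · rw [reduct_of_data_none g _ h, reduct_of_data_none g _ h]
      · rw [reduct_of_data_some g _ hn h, reduct_of_data_some g _ hn h]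
        refine Term.node_le_node fun i => ?_
        cases k with
        | zero => exact le_refl _
        | succ k => exact ih k (Nat.lt_succ_self k) _

theorem reduct_mono (g : p.L ⟶ G) (n : G.Node) : Monotone fun k => reduct g k n :=
  monotone_nat_of_le_succ fun k => reduct_le_succ g k n

/-- The occurrences from `n` of the redex root `g root` of length less than `k`, as redexes. -/
def redexes (g : p.L ⟶ G) (k : ℕ) (n : G.Node) : Set (List ℕ × RewriteRule S p.L.Var) :=
  {Δ | G.follow n Δ.1 = some (nodeMap g p.root) ∧ Δ.1.length < k ∧ Δ.2 = p.unravel}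

theorem redexes_eq_empty {g : p.L ⟶ G} {k : ℕ} {n : G.Node}
    (h : ∀ q, q.length < k → G.follow n q ≠ some (nodeMap g p.root)) : redexes g k n = ∅ :=
  Set.eq_empty_iff_forall_notMem.2 fun Δ hΔ => h Δ.1 hΔ.2.1 hΔ.1

/-- Apart from the redex itself, the redexes below the redex root lie below variables of `L`. -/
theorem redexes_root (hp : p.NonSelfOverlapping) (g : p.L ⟶ G) {k : ℕ} (hk : 0 < k) :
    redexes g k (nodeMap g p.root) =
      (⋃ x : p.L.Var, shift (p.pos x.1)
        (redexes g (k - (p.pos x.1).length) (nodeMap g x.1))) ∪ {([], p.unravel)} := by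
  have hfollow : ∀ (x : p.L.Var) q,
      G.follow (nodeMap g p.root) (p.pos x.1 ++ q) = G.follow (nodeMap g x.1) q := fun x q => by
    rw [follow_append, follow_root_pos, Option.bind_some]
  ext ⟨o, R⟩
  constructor
  · rintro ⟨h1, h2, h3⟩
    have h3 : R = p.unravel := h3
    subst h3
    -- It suffices to find a variable at a prefix of `o`.
    have key : ∀ (q r : List ℕ) (x : p.L.Var), o = q ++ r → p.L.follow p.root q = some x.1 →
        (o, p.unravel) ∈ ⋃ x : p.L.Var, shift (p.pos x.1)
          (redexes g (k - (p.pos x.1).length) (nodeMap g x.1)) := by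
      rintro q r x rfl hq
      obtain rfl := eq_pos hq
      refine Set.mem_iUnion.2 ⟨x, mem_shift.2 ⟨r, rfl, ?_, ?_, rfl⟩⟩
      · rw [← hfollow]
        exact h1
      · have h2 : (p.pos x.1 ++ r).length < k := h2
        rw [List.length_append] at h2
        change r.length < _
        omega
    rcases follow_nodeMap_cases g h1 with ⟨m, hm, hgm⟩ | ⟨q, r, x, hq, hx⟩
    · rcases hd : p.L.data m with _ | d
      · exact Or.inl (key o [] ⟨m, hd⟩ (List.append_nil o).symm hm)
      · right
        have hm' : m = p.root := hp.eq_root g (by simp [hd]) hgm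
        subst hm'
        have ho : o = [] := (eq_pos hm).trans (eq_pos (follow_nil p.L p.root)).symm
        rw [ho]
        rfl
    · exact Or.inl (key q r x hq hx)
  · rintro (h | h)
    · obtain ⟨x, hx⟩ := Set.mem_iUnion.1 h
      obtain ⟨q, hq, h1, h2, h3⟩ := mem_shift.1 hx
      have hq : o = p.pos x.1 ++ q := hq
      subst hq
      refine ⟨(hfollow x q).trans h1, ?_, h3⟩
      have h2 : q.length < k - (p.pos x.1).length := h2
      rw [List.length_append]
      omega
    · cases h
      exact ⟨follow_nil G _, hk, rfl⟩

theorem redexes_of_data_some {g : p.L ⟶ G} {k : ℕ} {n : G.Node} (hn : n ≠ nodeMap g p.root)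
    {f : S.Op} {s : Fin (S.arity f) → G.Node} (h : G.data n = some ⟨f, s⟩) :
    redexes g k n = ⋃ i, shift [i.1] (redexes g (k - 1) (s i)) := by
  ext ⟨o, R⟩
  rw [Set.mem_iUnion]
  constructor
  · rintro ⟨h1, h2, h3⟩
    rcases o with _ | ⟨i, o⟩
    · exact absurd (Option.some.inj ((follow_nil G n).symm.trans h1)) hn
    · have h1 : G.follow n (i :: o) = _ := h1
      rw [follow_cons_some h] at h1
      by_cases hi : i < S.arity f
      · rw [dif_pos hi] at h1
        refine ⟨⟨i, hi⟩, mem_shift.2 ⟨o, rfl, h1, ?_, h3⟩⟩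
        have h2 : (i :: o).length < k := h2
        rw [List.length_cons] at h2
        change o.length < k - 1
        omega
      · rw [dif_neg hi] at h1
        cases h1
  · rintro ⟨i, hi⟩
    obtain ⟨q, hq, h1, h2, h3⟩ := mem_shift.1 hi
    have hq : o = i.1 :: q := hq
    subst hq
    refine ⟨?_, ?_, h3⟩
    · change G.follow n (i.1 :: q) = _
      rw [follow_cons_some h, dif_pos i.2]
      exact h1
    · have h2 : q.length < k - 1 := h2
      rw [List.length_cons]
      omega

/-- Innermost contraction is a complete development of a truncated unraveling to its reduct: the
redexes below the variables of the outermost left-hand side are developed by induction, and then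
the outermost redex is contracted, which leaves no residuals. -/
theorem completeDevelopment_trunc (hp : p.NonSelfOverlapping) (g : p.L ⟶ G) (k : ℕ) (n : G.Node) :
    CompleteDevelopment (redexes g k n) (G.trunc (nodeMap g p.root) k n) (reduct g k n) := by
  induction k using Nat.strong_induction_on generalizing n with
  | _ k ih =>
    rcases Nat.eq_zero_or_pos k with rfl | hk
    · rw [reduct_zero, redexes_eq_empty (fun q hq => absurd hq (Nat.not_lt_zero _))]
      exact .nil _
    by_cases hn : n = nodeMap g p.root
    · subst hn
      have : Finite p.L.Node := p.L.finite_node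
      rw [trunc_root_eq_subst hp g hk, reduct_root g hk, redexes_root hp g hk]
      refine CompleteDevelopment.subst_linear p.unravel.lhs (fun x : p.L.Var => p.pos x.1)
        lhs_val_eq_var_iff (fun x => ih _ ?_ _) ?_ (CompleteDevelopment.root _ _)
      · have := length_pos_var x
        omega
      · rintro _ rfl x hx
        exact pos_var_ne_nil x (List.prefix_nil.1 hx)
    · rcases h : G.data n with _ | ⟨f, s⟩
      · rw [trunc_of_data_none (fun h' => absurd h' hn) h, reduct_of_data_none g k h,
          redexes_eq_empty]
        · exact .nil _
        · rintro (_ | ⟨i, q⟩) - hq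
          · exact hn (Option.some.inj ((follow_nil G n).symm.trans hq))
          · rw [follow_cons_none h] at hq
            cases hq
      · rw [trunc_of_data_some (fun h' => absurd h' hn) h, reduct_of_data_some g k hn h,
          redexes_of_data_some hn h]
        exact CompleteDevelopment.node fun i => ih _ (by omega) _

theorem isRedex_unravel (g : p.L ⟶ G) {n : G.Node} {o : List ℕ}
    (h : G.follow n o = some (nodeMap g p.root)) : (G.unravel n).IsRedex (o, p.unravel) := by
  refine ⟨by simp [Term.occ, TermGraph.unravel, h],
    fun x => (G.unravel (nodeMap g x.1)).subst Term.var, ?_⟩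
  change (G.unravel n).sub o = (p.L.unravel p.root).subst _
  have hvar : ∀ t : Term S G.Var, t.subst Term.var = t := fun t => by
    ext1
    funext o
    refine (Term.substVar_val (id : G.Var → G.Var) o t.val t.closed).trans ?_
    simp
  rw [unravel_sub h, ← unravel_nodeMap_subst, hvar]

theorem isRedex_trunc (hp : p.NonSelfOverlapping) (g : p.L ⟶ G) {n : G.Node} {o : List ℕ}
    (h : G.follow n o = some (nodeMap g p.root)) {k : ℕ} (hk : o.length < k) :
    (G.trunc (nodeMap g p.root) k n).IsRedex (o, p.unravel) := by
  refine ⟨?_, _, (trunc_sub h hk).trans (trunc_root_eq_subst hp g (Nat.sub_pos_of_lt hk))⟩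
  change (G.trunc (nodeMap g p.root) k n).val o ≠ none
  rw [trunc_val_of_lt hk]
  simp [TermGraph.unravel, h]

theorem finite_redexes (g : p.L ⟶ G) (k : ℕ) (n : G.Node) : (redexes g k n).Finite := by
  refine ((G.finite_follow_lt k n).image fun o => (o, p.unravel)).subset ?_
  rintro ⟨o, R⟩ ⟨h1, h2, h3⟩
  have h3 : R = p.unravel := h3
  exact ⟨o, ⟨by rw [h1]; exact Option.some_ne_none _, h2⟩, by rw [h3]⟩

theorem finiteParallelReduction_trunc (hp : p.NonSelfOverlapping) (g : p.L ⟶ G) (k : ℕ)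
    (n : G.Node) : FiniteParallelReduction (redexes g k n)
      (G.trunc (nodeMap g p.root) k n) (reduct g k n) := by
  refine ⟨finite_redexes g k n, ?_, completeDevelopment_trunc hp g k n⟩
  rintro ⟨o, R⟩ ⟨h1, h2, h3⟩
  have h3 : R = p.unravel := h3
  subst h3
  exact isRedex_trunc hp g h1 h2

end EvaluationRule

/-! ### Convergence of the reducts -/

namespace DirectDerivation

open TermGraph EvaluationRule

variable {S : Signature.{v}} {p : EvaluationRule.{u, v} S} {G H : TermGraph.{u, v} S}
  {g : p.L ⟶ G} (α : DirectDerivation p g H)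

theorem unravel_val_eq_trackTerm_val (hp : p.NonSelfOverlapping) {n : G.Node} {o : List ℕ}
    (h : ∀ q, q <+: o → G.follow n q ≠ some (nodeMap g p.root)) :
    (G.unravel n).val o = (α.trackTerm n).val o := by
  induction o generalizing n with
  | nil =>
    have hn : n ≠ nodeMap g p.root := fun hn => h [] List.nil_prefix (by rw [follow_nil, hn])
    rcases hd : G.data n with _ | ⟨f, s⟩
    · rw [α.trackTerm_of_data_none hp hd, unravel_of_data_none hd]
    · rw [α.trackTerm_of_data_some hn hd, unravel_of_data_some hd, Term.node_val_nil,
        Term.node_val_nil]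
  | cons i o ih =>
    have hn : n ≠ nodeMap g p.root := fun hn => h [] List.nil_prefix (by rw [follow_nil, hn])
    rcases hd : G.data n with _ | ⟨f, s⟩
    · rw [α.trackTerm_of_data_none hp hd, unravel_of_data_none hd]
    · rw [α.trackTerm_of_data_some hn hd, unravel_of_data_some hd, Term.node_val_cons,
        Term.node_val_cons]
      split_ifs with hi
      · refine ih fun q hq hf => h (i :: q) (List.cons_prefix_cons.2 ⟨rfl, hq⟩) ?_
        rw [follow_cons_some hd, dif_pos hi, hf]
      · rfl

theorem reduct_le_trackTerm (hp : p.NonSelfOverlapping) (k : ℕ) (n : G.Node) :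
    reduct g k n ≤ α.trackTerm n := by
  induction k using Nat.strong_induction_on generalizing n with
  | _ k ih =>
    rcases Nat.eq_zero_or_pos k with rfl | hk
    · rw [reduct_zero]
      intro o ho
      by_cases h : ∀ q, q <+: o → 0 ≤ q.length → G.follow n q ≠ some (nodeMap g p.root)
      · rw [trunc_val_of_forall h,
          α.unravel_val_eq_trackTerm_val hp fun q hq => h q hq (Nat.zero_le _)]
      · exact absurd (trunc_val_of_not h) ho
    by_cases hn : n = nodeMap g p.root
    · subst hn
      rw [reduct_root g hk, trackTerm_root]
      refine Term.subst_le_subst _ fun x => ih _ ?_ _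
      have := length_pos_var x
      omega
    · rcases h : G.data n with _ | ⟨f, s⟩
      · rw [reduct_of_data_none g k h, α.trackTerm_of_data_none hp h]
      · rw [reduct_of_data_some g k hn h, α.trackTerm_of_data_some hn h]
        exact Term.node_le_node fun i => ih _ (by omega) _

/-- If the truncation at `k` cuts nothing, the reduct is complete. -/
theorem reduct_eq_trackTerm (hp : p.NonSelfOverlapping) {k : ℕ} {n : G.Node}
    (h : ∀ q, k ≤ q.length → G.follow n q ≠ some (nodeMap g p.root)) :
    reduct g k n = α.trackTerm n := by
  induction k using Nat.strong_induction_on generalizing n with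
  | _ k ih =>
    rcases Nat.eq_zero_or_pos k with rfl | hk
    · rw [reduct_zero, trunc_of_forall h]
      ext1
      funext o
      exact α.unravel_val_eq_trackTerm_val hp fun q _ => h q (Nat.zero_le _)
    by_cases hn : n = nodeMap g p.root
    · subst hn
      rw [reduct_root g hk, trackTerm_root]
      congr 1
      funext x
      refine ih _ (by have := length_pos_var x; omega) fun q hq hf => ?_
      refine h (p.pos x.1 ++ q) (by rw [List.length_append]; omega) ?_
      rw [follow_append, follow_root_pos, Option.bind_some, hf]
    · rcases hd : G.data n with _ | ⟨f, s⟩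
      · rw [reduct_of_data_none g k hd, α.trackTerm_of_data_none hp hd]
      · rw [reduct_of_data_some g k hn hd, α.trackTerm_of_data_some hn hd]
        congr 1
        funext i
        refine ih _ (by omega) fun q hq hf => ?_
        refine h (i.1 :: q) (by rw [List.length_cons]; omega) ?_
        rw [follow_cons_some hd, dif_pos i.2, hf]

/-- Every occurrence of the track term is produced by some reduct. The induction is on its length,
which decreases when the path passes from a node other than the redex root to a successor, or
through the operators of the right-hand side. A collapsing rule leads from the redex root to a
different node without consuming anything, unless it leads back to the redex root, where the track
term is `⊥`. -/
theorem exists_reduct_val_ne_none (hp : p.NonSelfOverlapping) {n : G.Node} {o : List ℕ}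
    (h : (α.trackTerm n).val o ≠ none) : ∃ k, (reduct g k n).val o ≠ none := by
  induction hl : o.length using Nat.strong_induction_on generalizing n o with
  | _ l ih =>
    subst hl
    have hne : ∀ n, n ≠ nodeMap g p.root → (α.trackTerm n).val o ≠ none →
        ∃ k, (reduct g k n).val o ≠ none := by
      intro n hn h
      rcases hd : G.data n with _ | ⟨f, s⟩
      · refine ⟨0, ?_⟩
        rwa [reduct_of_data_none g 0 hd, ← α.trackTerm_of_data_none hp hd]
      · rw [α.trackTerm_of_data_some hn hd] at h
        rcases o with _ | ⟨i, o⟩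
        · refine ⟨0, ?_⟩
          rw [reduct_of_data_some g 0 hn hd, Term.node_val_nil]
          exact Option.some_ne_none _
        · rw [Term.node_val_cons] at h
          by_cases hi : i < S.arity f
          · rw [dif_pos hi] at h
            obtain ⟨k, hk⟩ := ih o.length (by simp) h rfl
            refine ⟨k + 1, ?_⟩
            rw [reduct_of_data_some g _ hn hd, Term.node_val_cons, dif_pos hi]
            exact hk
          · rw [dif_neg hi] at h
            exact absurd rfl h
    by_cases hn : n = nodeMap g p.root
    · subst hn
      have h0 := h
      rw [trackTerm_root] at h
      rcases p.unravel.rhs.subst_val_cases o with ⟨f, hf⟩ | ⟨b, q, x, rfl, hx⟩ | hnone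
      · refine ⟨1, ?_⟩
        rw [reduct_root g one_pos, Term.subst_val_op _ hf]
        exact Option.some_ne_none _
      · rw [Term.subst_val_var _ _ hx] at h
        have hk : ∃ k, (reduct g k (nodeMap g x.1)).val q ≠ none := by
          by_cases hb : b = []
          · subst hb
            refine hne _ (fun hg => ?_) h
            rw [α.trackTerm_root_of_cycle hp hx hg] at h0
            exact h0 rfl
          · refine ih q.length ?_ h rfl
            rw [List.length_append]
            have := List.length_pos_iff.2 hb
            omega
        obtain ⟨k, hk⟩ := hk
        refine ⟨k + (p.pos x.1).length, ?_⟩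
        rw [reduct_root g (Nat.add_pos_right k (length_pos_var x)), Term.subst_val_var _ _ hx,
          Nat.add_sub_cancel]
        exact hk
      · exact absurd (hnone _) h
    · exact hne n hn h

theorem isLUB_range_reduct (hp : p.NonSelfOverlapping) (n : G.Node) :
    IsLUB (Set.range fun k => reduct g k n) (α.trackTerm n) := by
  constructor
  · rintro _ ⟨k, rfl⟩
    exact α.reduct_le_trackTerm hp k n
  · intro t ht o ho
    obtain ⟨k, hk⟩ := α.exists_reduct_val_ne_none hp ho
    rw [ht ⟨k, rfl⟩ o hk, α.reduct_le_trackTerm hp k n o hk]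

theorem parallelReduction (hp : p.NonSelfOverlapping) (n : G.Node) :
    ParallelReduction
      {Δ : List ℕ × RewriteRule S p.L.Var |
        G.follow n Δ.1 = some (nodeMap g p.root) ∧ Δ.2 = p.unravel}
      (G.unravel n) (α.trackTerm n) := by
  set Φ := {Δ : List ℕ × RewriteRule S p.L.Var |
    G.follow n Δ.1 = some (nodeMap g p.root) ∧ Δ.2 = p.unravel} with hΦ
  by_cases hfin : Φ.Finite
  · -- All redexes are shorter than some `k`, so that truncation at `k` changes nothing.
    left
    obtain ⟨k, hk⟩ := (hfin.image fun Δ => Δ.1.length).bddAbove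
    have hlt : ∀ Δ ∈ Φ, Δ.1.length < k + 1 := fun Δ hΔ =>
      Nat.lt_succ_of_le (hk ⟨Δ, hΔ, rfl⟩)
    have hlong : ∀ q, k + 1 ≤ q.length → G.follow n q ≠ some (nodeMap g p.root) :=
      fun q hq hf => absurd (hlt (q, p.unravel) ⟨hf, rfl⟩) (not_lt.2 hq)
    have hred : redexes g (k + 1) n = Φ :=
      Set.ext fun Δ => ⟨fun h => ⟨h.1, h.2.2⟩, fun h => ⟨h.1, hlt Δ h, h.2⟩⟩
    have h := finiteParallelReduction_trunc hp g (k + 1) n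
    rwa [hred, trunc_of_forall hlong, α.reduct_eq_trackTerm hp hlong] at h
  · right
    refine ⟨hfin, ?_, fun k => G.trunc (nodeMap g p.root) k n, fun k => reduct g k n,
      trunc_mono, isLUB_range_trunc, ?_, ?_, reduct_mono g n, α.isLUB_range_reduct hp n⟩
    · rintro ⟨o, R⟩ ⟨h1, h2⟩
      have h2 : R = p.unravel := h2
      subst h2
      exact isRedex_unravel g h1
    · rintro k ⟨o, R⟩ ⟨h1, h2⟩
      have h2 : R = p.unravel := h2
      subst h2
      rcases Nat.lt_or_ge o.length k with h | h
      · exact Or.inl (isRedex_trunc hp g h1 h)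
      · exact Or.inr (trunc_val_of_follow h1 h)
    · intro k
      have hred : {Δ ∈ Φ | (G.trunc (nodeMap g p.root) k n).IsRedex Δ} = redexes g k n := by
        ext ⟨o, R⟩
        constructor
        · rintro ⟨⟨h1, h2⟩, h3⟩
          refine ⟨h1, ?_, h2⟩
          by_contra h
          exact h3.1 (trunc_val_of_follow h1 (not_lt.1 h))
        · rintro ⟨h1, h2, h3⟩
          have h3 : R = p.unravel := h3
          subst h3
          exact ⟨⟨h1, rfl⟩, isRedex_trunc hp g h1 h2⟩
      rw [hred]
      exact finiteParallelReduction_trunc hp g k n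

end DirectDerivation

/-! ### The evaluation theorem -/

/-- A direct derivation by a non-self-overlapping evaluation rule exists at every occurrence, and
for each such derivation the track function maps variable nodes injectively to variable nodes (so
that the substitution `trackBack` is well defined) and, for each node `n`, the unraveling of `G` at
`n` reduces to the instance by `trackBack` of the unraveling of `H` at the track of `n`, by the
parallel reduction of the rule `U[p]` at the occurrences of all paths from `n` to the image of the
root. -/
theorem mainTheorem1 {S : Signature.{v}} (p : EvaluationRule.{u, v} S)
    (hp : p.NonSelfOverlapping) (G : TermGraph.{u, v} S) (g : p.L ⟶ G) :
    (∃ H : TermGraph.{u, v} S, Nonempty (DirectDerivation p g H)) ∧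
    ∀ (H : TermGraph.{u, v} S) (α : DirectDerivation p g H),
      Set.MapsTo α.track G.varSet H.varSet ∧ Set.InjOn α.track G.varSet ∧
      ∀ n : G.Node,
        ParallelReduction
          {Δ : List ℕ × RewriteRule S p.L.Var |
            G.follow n Δ.1 = some (TermGraph.nodeMap g p.root) ∧ Δ.2 = p.unravel}
          (G.unravel n)
          ((H.unravel (α.track n)).subst α.trackBack) := by
  exact ⟨⟨_, ⟨EvaluationRule.derivation hp g⟩⟩, fun _ α =>
    ⟨α.mapsTo_track hp, α.injOn_track hp, α.parallelReduction hp⟩⟩
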